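/- Let $p$ be a prime, $k$ an algebraic closure of $\mathbf{F}_p$, and let $G=Sp(4)$ be the group of $g\in GL_4$ with ${}^tg\Psi g=\Psi$, where $\Psi=\begin{pmatrix}0&-J\\J&0\end{pmatrix}$, $J=\begin{pmatrix}0&1\\1&0\end{pmatrix}$. Let $(u_1,\dots,u_4)$ be the canonical basis of $k^4$. Let $B\subset G$ be the lower-triangular Borel subgroup, $T$ the diagonal torus, $P\supset B$ (resp. $Q$) the stabilizer of $\mathrm{Span}(u_3,u_4)$ (resp. $\mathrm{Span}(u_1,u_2)$), $L=P\cap Q\simeq GL_2$, $B_L=B\cap L$. Let $\varphi$ be the $p$-power Frobenius and $$E=\{(x,y)\in P\times Q:\ \varphi(\bar x)=\bar y\},$$ where $\bar x,\bar y\in L$ are the Levi components; $E$ acts on $G$ by $(x,y)\cdot g=xgy^{-1}$. Identify $X^*(T)=\mathbf{Z}^2$, with $(a_1,a_2)$ corresponding to $\mathrm{diag}(x_1,x_2,x_2^{-1},x_1^{-1})\mapsto x_1^{a_1}x_2^{a_2}$. For $\lambda\in\mathbf{Z}^2$ let $V(\lambda)=\mathrm{Ind}_{B_L}^L(\lambda)$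 be the space of regular functions $f$ on $L$ with $f(lb)=\lambda(b)^{-1}f(l)$ for $l\in L$, $b\in B_L$, on which $L$ acts by left translation $(l\cdot f)(x)=f(l^{-1}x)$ and on which $E$ acts via $(x,y)\mapsto \bar x$. Let $H^0(\lambda)$ be the space of regular maps $F:G\to V(\lambda)$ with $F(\varepsilon\cdot g)=\varepsilon F(g)$ for all $\varepsilon\in E$, $g\in G$ (the global sections of $\mathscr V(\lambda)$ over the stack $[E\backslash G]$ of $G$-zips), and let $$C_{\rm zip}=\{\lambda\in\mathbf{Z}^2:\ H^0(\lambda)\neq0\}.$$ For $C\subset\mathbf{Z}^2$ put $\langle C\rangle=\{x\in\mathbf{Z}^2:\ nx\in C\text{ for some integer }n\geq1\}$; call a submonoid $C$ saturated if $\langle C\rangle=C$, and let $\langle m_1,\dots,m_r\rangle$ be the smallest saturated submonoid of $\mathbf{Z}^2$ containing $m_1,\dots,m_r$. The simple roots are $\alpha=e_1-e_2$ (the simple root of $L$) and $\beta=2e_2$; let $W_L=\{1,s_\alpha\}$ be the Weyl group of $L$, $\ell$ the length, $w_0$ and $w_{0,L}$ the longest elements of the Weyl groups of $G$ and $L$,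 and $z=w_{0,L}w_0$. The Schubert cone $C_{\rm Sbt}$ is the image of the set of dominant characters under $h(\lambda)=\lambda-(zw_0\lambda)\circ\varphi=\lambda-p\,zw_0\lambda$, and the highest weight cone is $$C_{\rm hw}=\Big\{\lambda\in\mathbf{Z}^2:\ \langle\lambda,\alpha^\vee\rangle\geq0,\ \sum_{w\in W_L}p^{\ell(w)}\langle w\lambda,\beta^\vee\rangle\leq0\Big\}.$$ Then $$C_{\rm zip}=\mathbf{N}(1,-p)+\mathbf{N}(1-p,1-p)+\mathbf{N}(0,-p(p-1)),$$ and $$\langle C_{\rm zip}\rangle=\{(a_1,a_2)\in\mathbf{Z}^2:\ a_1\geq a_2,\ pa_1+a_2\leq0\}=\langle(1,-p),(-1,-1)\rangle=\langle C_{\rm Sbt}\rangle=C_{\rm hw}.$$ -/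

import Mathlib

open scoped MatrixGroups

noncomputable section

namespace ZipSp4

/-! ### The group `Sp(4)` and its subgroups -/

/-- The matrix of the symplectic form, with blocks `0, -J, J, 0` and `J` antidiagonal. -/
def formMatrix (R : Type*) [CommRing R] : Matrix (Fin 4) (Fin 4) R :=
  !![0, 0, 0, -1; 0, 0, -1, 0; 0, 1, 0, 0; 1, 0, 0, 0]

/-- The group `G(k) = Sp(4)(k)`: matrices `g` with `ᵗg Ψ g = Ψ`. -/
def Sp4 (k : Type*) [Field k] : Subgroup (GL (Fin 4) k) where
  carrier := {g | (g : Matrix (Fin 4) (Fin 4) k).transpose * formMatrix k *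
    (g : Matrix (Fin 4) (Fin 4) k) = formMatrix k}
  one_mem' := by simp
  mul_mem' := by
    intro a b (ha : (a : Matrix (Fin 4) (Fin 4) k).transpose * formMatrix k *
      (a : Matrix (Fin 4) (Fin 4) k) = formMatrix k)
      (hb : (b : Matrix (Fin 4) (Fin 4) k).transpose * formMatrix k *
      (b : Matrix (Fin 4) (Fin 4) k) = formMatrix k)
    change ((a : Matrix (Fin 4) (Fin 4) k) * (b : Matrix (Fin 4) (Fin 4) k)).transpose *
      formMatrix k * ((a : Matrix (Fin 4) (Fin 4) k) * (b : Matrix (Fin 4) (Fin 4) k)) = _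
    rw [Matrix.transpose_mul]
    calc _ = (b : Matrix (Fin 4) (Fin 4) k).transpose *
          ((a : Matrix (Fin 4) (Fin 4) k).transpose * formMatrix k *
            (a : Matrix (Fin 4) (Fin 4) k)) * (b : Matrix (Fin 4) (Fin 4) k) := by
            simp only [Matrix.mul_assoc]
      _ = _ := by rw [ha, hb]
  inv_mem' := by
    intro a (ha : (a : Matrix (Fin 4) (Fin 4) k).transpose * formMatrix k *
      (a : Matrix (Fin 4) (Fin 4) k) = formMatrix k)
    change ((a⁻¹ : GL (Fin 4) k) : Matrix (Fin 4) (Fin 4) k).transpose * formMatrix k *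
      ((a⁻¹ : GL (Fin 4) k) : Matrix (Fin 4) (Fin 4) k) = formMatrix k
    have h1 : (a : Matrix (Fin 4) (Fin 4) k) * ((a⁻¹ : GL (Fin 4) k) :
        Matrix (Fin 4) (Fin 4) k) = 1 := by
      rw [← Units.val_mul, mul_inv_cancel, Units.val_one]
    have h2 : ((a⁻¹ : GL (Fin 4) k) : Matrix (Fin 4) (Fin 4) k).transpose *
        (a : Matrix (Fin 4) (Fin 4) k).transpose = 1 := by
      rw [← Matrix.transpose_mul, h1, Matrix.transpose_one]
    conv_lhs => rw [← ha]
    calc _ = (((a⁻¹ : GL (Fin 4) k) : Matrix (Fin 4) (Fin 4) k).transpose *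
        (a : Matrix (Fin 4) (Fin 4) k).transpose) * formMatrix k *
        ((a : Matrix (Fin 4) (Fin 4) k) * ((a⁻¹ : GL (Fin 4) k) :
        Matrix (Fin 4) (Fin 4) k)) := by simp only [Matrix.mul_assoc]
      _ = _ := by rw [h1, h2, one_mul, mul_one]

section Subgroups

/-- The matrix of an element of `Sp(4)`. -/
def mat {k : Type*} [Field k] (g : Sp4 k) : Matrix (Fin 4) (Fin 4) k :=
  ((g : GL (Fin 4) k) : Matrix (Fin 4) (Fin 4) k)

theorem mat_one {k : Type*} [Field k] : mat (1 : Sp4 k) = 1 := rfl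

theorem mat_mul {k : Type*} [Field k] (g h : Sp4 k) : mat (g * h) = mat g * mat h := rfl

theorem mat_inv {k : Type*} [Field k] (g : Sp4 k) : mat g⁻¹ = (mat g)⁻¹ :=
  Matrix.coe_units_inv (g : GL (Fin 4) k)

variable (k : Type*) [Field k]

/-- The stabilizer in `Sp(4)` of a subspace `U` of `k⁴`. -/
def stab (U : Submodule k (Fin 4 → k)) : Subgroup (Sp4 k) where
  carrier := {g | U.map (mat g).mulVecLin = U}
  one_mem' := by
    change U.map (mat 1).mulVecLin = U
    rw [mat_one, Matrix.mulVecLin_one, Submodule.map_id]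
  mul_mem' := by
    intro a b (ha : U.map (mat a).mulVecLin = U) (hb : U.map (mat b).mulVecLin = U)
    change U.map (mat (a * b)).mulVecLin = U
    rw [mat_mul, Matrix.mulVecLin_mul, Submodule.map_comp, hb, ha]
  inv_mem' := by
    intro a (ha : U.map (mat a).mulVecLin = U)
    change U.map (mat a⁻¹).mulVecLin = U
    conv_lhs => rw [← ha]
    rw [← Submodule.map_comp, ← Matrix.mulVecLin_mul, ← mat_mul, inv_mul_cancel, mat_one,
      Matrix.mulVecLin_one, Submodule.map_id]

/-- The elements of `Sp(4)` acting trivially on `U` and on `k⁴ / U`. When `U` is Lagrangian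
this is the unipotent radical of the parabolic subgroup `stab k U`. -/
def unipotentRadical (U : Submodule k (Fin 4 → k)) : Set (Sp4 k) :=
  {g | (∀ v ∈ U, (mat g).mulVec v = v) ∧ ∀ v, (mat g).mulVec v - v ∈ U}

/-- The span of the first two vectors of the canonical basis. -/
def firstHalf : Submodule k (Fin 4 → k) := Submodule.span k {Pi.single 0 1, Pi.single 1 1}

/-- The span of the last two vectors of the canonical basis. -/
def lastHalf : Submodule k (Fin 4 → k) := Submodule.span k {Pi.single 2 1, Pi.single 3 1}

/-- The parabolic subgroup `P`. -/
def P : Subgroup (Sp4 k) := stab k (lastHalf k)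

/-- The opposite parabolic subgroup `Q`. -/
def Q : Subgroup (Sp4 k) := stab k (firstHalf k)

/-- The common Levi subgroup `L = P ∩ Q`, isomorphic to `GL(2)`. -/
def L : Subgroup (Sp4 k) := P k ⊓ Q k

/-- `R_u(P)`. -/
def RuP : Set (Sp4 k) := unipotentRadical k (lastHalf k)

/-- `R_u(Q)`. -/
def RuQ : Set (Sp4 k) := unipotentRadical k (firstHalf k)

/-- The Borel subgroup `B` of lower-triangular matrices in `Sp(4)`. -/
def B : Subgroup (Sp4 k) where
  carrier := {g | (mat g).BlockTriangular OrderDual.toDual}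
  one_mem' := Matrix.blockTriangular_one
  mul_mem' := by
    intro a b (ha : (mat a).BlockTriangular OrderDual.toDual)
      (hb : (mat b).BlockTriangular OrderDual.toDual)
    change (mat (a * b)).BlockTriangular OrderDual.toDual
    rw [mat_mul]
    exact ha.mul hb
  inv_mem' := by
    intro a (ha : (mat a).BlockTriangular OrderDual.toDual)
    change (mat a⁻¹).BlockTriangular OrderDual.toDual
    have : Invertible (mat a) := (a : GL (Fin 4) k).invertible
    rw [mat_inv]
    exact Matrix.blockTriangular_inv_of_blockTriangular ha

/-- The relation "`l ∈ L` is the Levi component of `x`" for a parabolic subgroup with Levi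
subgroup `L` and unipotent radical `U`: one has `x = u l` for some `u ∈ U`. -/
def IsLeviComponent {k : Type*} [Field k] (U : Set (Sp4 k)) (x : Sp4 k) (l : L k) : Prop :=
  ∃ u ∈ U, x = u * (l : Sp4 k)

end Subgroups

/-! ### Frobenius and the zip group -/

section Frobenius

variable (p : ℕ) [Fact p.Prime] (k : Type*) [Field k] [Algebra (ZMod p) k]

/-- The `p`-power Frobenius of a field containing `𝔽_p`. -/
def frob : k →+* k :=
  haveI : CharP k p := charP_of_injective_algebraMap (algebraMap (ZMod p) k).injective p
  frobenius k p

theorem frob_apply (x : k) : frob p k x = x ^ p := rfl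

/-- The Frobenius homomorphism `φ : G → G`, raising all matrix entries to the power `p`. -/
def frobSp4 : Sp4 k →* Sp4 k :=
  ((Matrix.GeneralLinearGroup.map (frob p k)).comp (Sp4 k).subtype).codRestrict (Sp4 k) (by
    rintro ⟨g, hg⟩
    have hg' : (g : Matrix (Fin 4) (Fin 4) k).transpose * formMatrix k *
        (g : Matrix (Fin 4) (Fin 4) k) = formMatrix k := hg
    have hJ : (formMatrix k).map (frob p k) = formMatrix k := by
      ext i j
      fin_cases i <;> fin_cases j <;> simp [formMatrix]
    change ((g : Matrix (Fin 4) (Fin 4) k).map (frob p k)).transpose * formMatrix k *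
        ((g : Matrix (Fin 4) (Fin 4) k).map (frob p k)) = formMatrix k
    conv_rhs => rw [← hJ, ← hg', Matrix.map_mul, Matrix.map_mul, hJ]
    rw [Matrix.transpose_map])

/-- The zip group `E`: pairs `(x, y) ∈ P × Q` whose Levi components satisfy `φ(x̄) = ȳ`. -/
def zipGroup : Set (Sp4 k × Sp4 k) :=
  {e | e.1 ∈ P k ∧ e.2 ∈ Q k ∧ ∃ l m : L k, IsLeviComponent (RuP k) e.1 l ∧
    IsLeviComponent (RuQ k) e.2 m ∧ frobSp4 p k (l : Sp4 k) = (m : Sp4 k)}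

end Frobenius

/-! ### Regular functions, the representations `V(λ)`, and sections over the stack of zips -/

section Sections

variable (k : Type*) [Field k]

/-- Regular functions on a closed subgroup `H` of `Sp(4)`: restrictions of polynomials in the
16 matrix entries (`Sp(4)` is closed in the space of `4 × 4` matrices). -/
def regularFunctions (H : Subgroup (Sp4 k)) : Submodule k (H → k) where
  carrier := {f | ∃ F : MvPolynomial (Fin 4 × Fin 4) k,
    ∀ h : H, f h = F.eval fun ij => mat (h : Sp4 k) ij.1 ij.2}
  zero_mem' := ⟨0, by simp⟩
  add_mem' := by
    rintro a b ⟨F, hF⟩ ⟨F', hF'⟩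
    exact ⟨F + F', fun h => by simp [hF h, hF' h]⟩
  smul_mem' := by
    rintro c a ⟨F, hF⟩
    exact ⟨MvPolynomial.C c * F, fun h => by simp [hF h]⟩

/-- The value at `b ∈ B` of the character `λ = (a₁, a₂)` of `T ≅ B / R_u(B)`, which sends
`diag(x₁, x₂, x₂⁻¹, x₁⁻¹)` to `x₁ ^ a₁ * x₂ ^ a₂`. -/
def charValue {k : Type*} [Field k] (lam : ℤ × ℤ) (b : Sp4 k) : k :=
  mat b 0 0 ^ lam.1 * mat b 1 1 ^ lam.2

/-- `V(λ) = H⁰(L/B_L, ℒ(λ)) = Ind_{B_L}^L λ`: regular functions `f` on `L` such that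
`f(l b) = λ(b)⁻¹ f(l)` for all `l ∈ L` and `b ∈ B_L = B ∩ L`. -/
def V (lam : ℤ × ℤ) : Submodule k (L k → k) where
  carrier := {f | f ∈ regularFunctions k (L k) ∧
    ∀ l b : L k, (b : Sp4 k) ∈ B k → f (l * b) = (charValue lam (b : Sp4 k))⁻¹ * f l}
  zero_mem' := ⟨Submodule.zero_mem _, by simp⟩
  add_mem' := by
    rintro f g ⟨hf, hf'⟩ ⟨hg, hg'⟩
    exact ⟨Submodule.add_mem _ hf hg, fun l b hb => by
      simp only [Pi.add_apply, hf' l b hb, hg' l b hb, mul_add]⟩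
  smul_mem' := by
    rintro c f ⟨hf, hf'⟩
    exact ⟨Submodule.smul_mem _ c hf, fun l b hb => by
      simp only [Pi.smul_apply, hf' l b hb, smul_eq_mul]; ring⟩

theorem regular_translate {l : L k} {f : L k → k} (hf : f ∈ regularFunctions k (L k)) :
    (fun x => f (l⁻¹ * x)) ∈ regularFunctions k (L k) := by
  obtain ⟨F, hF⟩ := hf
  refine ⟨MvPolynomial.bind₁ (fun ij : Fin 4 × Fin 4 =>
    ∑ m : Fin 4, MvPolynomial.C (mat ((l⁻¹ : L k) : Sp4 k) ij.1 m) *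
      MvPolynomial.X (m, ij.2)) F, fun h => ?_⟩
  change f (l⁻¹ * h) = _
  rw [hF]
  refine Eq.trans ?_ (MvPolynomial.eval₂Hom_bind₁ (RingHom.id k) _ _ F).symm
  refine congrArg (fun v => MvPolynomial.eval₂Hom (RingHom.id k) v F) (funext fun ij => ?_)
  change mat (((l⁻¹ : L k) : Sp4 k) * (h : Sp4 k)) ij.1 ij.2 = _
  rw [mat_mul, Matrix.mul_apply]
  simp

/-- The action of `L` on `V(λ)` by left translation, `(l · f)(x) = f(l⁻¹ x)`. -/
def rep (lam : ℤ × ℤ) : Representation k (L k) (V k lam) where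
  toFun l :=
    { toFun := fun f => ⟨fun x => f.1 (l⁻¹ * x), regular_translate k f.2.1, fun x b hb => by
        change f.1 (l⁻¹ * (x * b)) = _
        rw [← mul_assoc]; exact f.2.2 _ b hb⟩
      map_add' := fun _ _ => rfl
      map_smul' := fun _ _ => rfl }
  map_one' := by ext f x; simp
  map_mul' := fun a b => by ext f x; simp [mul_assoc]

/-- Regular maps from `G` to a finite-dimensional vector space `M`: the image of `k[G] ⊗ M`. -/
def regularMaps (M : Type*) [AddCommGroup M] [Module k M] : Submodule k (Sp4 k → M) :=
  Submodule.span k {F | ∃ f ∈ regularFunctions k ⊤, ∃ v : M,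
    F = fun g => f ⟨g, Subgroup.mem_top g⟩ • v}

variable (p : ℕ) [Fact p.Prime] [Algebra (ZMod p) k]

/-- The space `H⁰(G-Zip, 𝒱(λ))` of global sections over `[E \ G]` of the vector bundle attached
to `V(λ)`: regular maps `F : G → V(λ)` with `F(x g y⁻¹) = (x, y) · F(g)` for all
`(x, y) ∈ E`, where `(x, y)` acts on `V(λ)` through the Levi component of `x`. -/
def H0 (lam : ℤ × ℤ) : Submodule k (Sp4 k → V k lam) where
  carrier := {F | F ∈ regularMaps k (V k lam) ∧
    ∀ e ∈ zipGroup p k, ∀ l : L k, IsLeviComponent (RuP k) e.1 l →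
      ∀ g : Sp4 k, F (e.1 * g * e.2⁻¹) = rep k lam l (F g)}
  zero_mem' := ⟨Submodule.zero_mem _, by simp⟩
  add_mem' := by
    rintro F F' ⟨h1, h2⟩ ⟨h1', h2'⟩
    exact ⟨Submodule.add_mem _ h1 h1', fun e he l hl g => by
      simp only [Pi.add_apply, h2 e he l hl g, h2' e he l hl g, map_add]⟩
  smul_mem' := by
    rintro c F ⟨h1, h2⟩
    exact ⟨Submodule.smul_mem _ c h1, fun e he l hl g => by
      simp only [Pi.smul_apply, h2 e he l hl g, map_smul]⟩

/-- The zip cone: weights `λ` such that `𝒱(λ)` has a nonzero global section. -/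
def Czip : Set (ℤ × ℤ) := {lam | H0 k p lam ≠ ⊥}

end Sections

/-! ### Cones in the character lattice -/

/-- `⟨C⟩ = {x | n x ∈ C for some n ≥ 1}`. -/
def saturation (C : Set (ℤ × ℤ)) : Set (ℤ × ℤ) := {x | ∃ n : ℕ, 1 ≤ n ∧ n • x ∈ C}

/-- `⟨m₁, …, m_r⟩`, the smallest saturated cone containing the given elements. -/
def sGenerated (S : Set (ℤ × ℤ)) : AddSubmonoid (ℤ × ℤ) :=
  sInf {C | saturation (C : Set (ℤ × ℤ)) = C ∧ S ⊆ C}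

/-! ### Roots, Weyl group, Schubert cone and highest weight cone

The torus `T` is split, so Galois acts trivially on characters, on roots and on the Weyl group,
and `χ ∘ φ = p χ` for every character `χ` of `T`. -/

/-- The simple roots: index `0` is `e₁ - e₂` (the simple root of `L`, so `I = {0}`), and
index `1` is `2 e₂`. -/
def simpleRoot : Fin 2 → ℤ × ℤ := ![(1, -1), (0, 2)]

/-- The simple coroots, in the dual basis of cocharacters. -/
def simpleCoroot : Fin 2 → ℤ × ℤ := ![(1, -1), (0, 1)]

/-- The linear form `χ ↦ ⟨χ, αᵢ^∨⟩` on characters. -/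
def pairing (i : Fin 2) : Module.Dual ℤ (ℤ × ℤ) :=
  (simpleCoroot i).1 • LinearMap.fst ℤ ℤ ℤ + (simpleCoroot i).2 • LinearMap.snd ℤ ℤ ℤ

theorem pairing_self (i : Fin 2) : pairing i (simpleRoot i) = 2 := by
  fin_cases i <;> simp [pairing, simpleRoot, simpleCoroot]

/-- The simple reflection `χ ↦ χ - ⟨χ, αᵢ^∨⟩ αᵢ`. -/
def simpleReflection (i : Fin 2) : (ℤ × ℤ) ≃ₗ[ℤ] (ℤ × ℤ) := Module.reflection (pairing_self i)

/-- The Weyl group `W_L`, generated by the simple reflections with index in `I`. -/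
def weylL : Subgroup ((ℤ × ℤ) ≃ₗ[ℤ] (ℤ × ℤ)) := Subgroup.closure {simpleReflection 0}

/-- The length of a Weyl group element: the least length of a word in the simple reflections
of `G` with product `w`. -/
def length (w : (ℤ × ℤ) ≃ₗ[ℤ] (ℤ × ℤ)) : ℕ :=
  sInf {n | ∃ u : List (Fin 2), u.length = n ∧ (u.map simpleReflection).prod = w}

/-- The longest element `w₀` of the Weyl group of `Sp(4)`, by a reduced expression. -/
def w0 : (ℤ × ℤ) ≃ₗ[ℤ] (ℤ × ℤ) :=
  simpleReflection 0 * simpleReflection 1 * simpleReflection 0 * simpleReflection 1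

/-- The longest element of `W_L`. -/
def w0L : (ℤ × ℤ) ≃ₗ[ℤ] (ℤ × ℤ) := simpleReflection 0

theorem w0L_apply (a b : ℤ) : w0L (a, b) = (b, a) := by
  simp [w0L, simpleReflection, Module.reflection_apply, pairing, simpleRoot, simpleCoroot]

/-- `w₀` makes all positive roots negative. -/
theorem w0_apply (x : ℤ × ℤ) : w0 x = -x := by
  ext <;> simp [w0, simpleReflection, Module.reflection_apply, pairing, simpleRoot,
    simpleCoroot] <;> ring

/-- The element `z = w_{0,I} w₀` of the frame `(B, T, z)`. -/
def frameElt : (ℤ × ℤ) ≃ₗ[ℤ] (ℤ × ℤ) := w0L * w0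

/-- The map `h(χ) = χ - (z w₀ χ) ∘ φ` on characters. -/
def schubertMap (p : ℕ) (x : ℤ × ℤ) : ℤ × ℤ := x - (p : ℤ) • (frameElt * w0) x

/-- The Schubert cone `h(X₊^*(T))`, the image of the dominant characters. -/
def CSbt (p : ℕ) : Set (ℤ × ℤ) := schubertMap p '' {x | ∀ i, 0 ≤ pairing i x}

/-- The highest weight cone: `L`-dominant `λ` with
`∑_{w ∈ W_L} p ^ ℓ(w) ⟨w λ, α^∨⟩ ≤ 0` for the unique simple root `α` outside `I`. -/
def Chw (p : ℕ) : Set (ℤ × ℤ) :=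
  {x | 0 ≤ pairing 0 x ∧ ∑ᶠ w : weylL, (p : ℤ) ^ length w.1 * pairing 1 (w.1 x) ≤ 0}

end ZipSp4

end

/-!
A section `F` of `𝒱(λ)` is determined by the function `h(g) = F(g)(1)` on `Sp(4)`, since
`F(g)(l) = h(l⁻¹ g φ(l))`. In terms of `h` the conditions on `F` say that `h` is regular, invariant
under `R_u(P)` on the left and `R_u(Q)` on the right, and that `h(b g φ(b)⁻¹) = λ(b) h(g)` for `b`
in `B_L`. By the unipotent invariance `h` depends, on the big cell, only on the upper left block
`A = !![a, b; c, d]` of `g`. So the zip cone consists of the weights of semi-invariant functions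
of `A` under Frobenius-twisted conjugation by lower triangular matrices. Three polynomial
semi-invariants are `b`, `det A` and `d ^ p + a b ^ (p - 1)`, of weights `(1, -p)`,
`(1 - p, 1 - p)` and `(0, -p (p - 1))`. Their products give sections
(`IsSemiinvariantWeight.mem_Czip`).

Conversely, where `b ≠ 0` a block can be moved to the form `!![e, 1; c, 0]`
(`IsSemiinvariant.levi_eq_slice`). These blocks extend to a plane in `Sp(4)`, including the points
`c = 0` outside the big cell, so that `h` restricts to a polynomial `Φ(e, c)`, which is nonzero by
a density argument (`IsSemiinvariant.exists_slice_ne_zero`). If `c ^ l` is the exact power of `c`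
dividing `Φ`, the lowest coefficient of `Φ` is a monomial in `e` of some degree `i`, by
semi-invariance under the torus that preserves the slice. Moving the blocks `!![-1, b; 0, 1]` to
the slice gives `h = b ^ λ₁ Φ(1 - b ^ (p - 1), b ^ (p - 1))`, which has order
`j = λ₁ + (p - 1) l` at `b = 0`. As `h` is regular there, `j ≥ 0`. Then
`λ = i (0, -p (p - 1)) + j (1, -p) + l (1 - p, 1 - p)` (`IsSemiinvariant.weight_eq`).

The other descriptions follow by integer arithmetic: every saturation in question equals the cone
`a₁ ≥ a₂`, `p a₁ + a₂ ≤ 0`, which is spanned over the rationals by `(1, -p)` and `(-1, -1)`.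
-/

noncomputable section

namespace ZipSp4

/-! ### Coordinates on `Sp(4)` -/

section Coordinates

variable {k : Type*} [Field k]

/-- The element of `Sp(4)` with a given matrix preserving the symplectic form. -/
def ofMatrix (M : Matrix (Fin 4) (Fin 4) k)
    (hM : M.transpose * formMatrix k * M = formMatrix k) : Sp4 k :=
  have hsq : -formMatrix k * formMatrix k = 1 := by
    ext i j; fin_cases i <;> fin_cases j <;> simp [formMatrix, Matrix.mul_apply, Fin.sum_univ_four]
  have hinv : -formMatrix k * M.transpose * formMatrix k * M = 1 := by
    rw [mul_assoc, mul_assoc, ← mul_assoc M.transpose, hM, hsq]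
  ⟨⟨M, -formMatrix k * M.transpose * formMatrix k, mul_eq_one_comm.mp hinv, hinv⟩, hM⟩

@[simp]
theorem mat_ofMatrix (M : Matrix (Fin 4) (Fin 4) k)
    (hM : M.transpose * formMatrix k * M = formMatrix k) : mat (ofMatrix M hM) = M := rfl

theorem mat_injective : Function.Injective (mat (k := k)) := fun _ _ h =>
  Subtype.ext (Units.ext h)

theorem transpose_mul_form_mul (g : Sp4 k) :
    (mat g).transpose * formMatrix k * mat g = formMatrix k := g.2

/-- The columns of a symplectic matrix form a symplectic basis. -/
theorem form_columns (g : Sp4 k) (i j : Fin 4) :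
    -(mat g 0 i * mat g 3 j) - mat g 1 i * mat g 2 j + mat g 2 i * mat g 1 j
      + mat g 3 i * mat g 0 j = formMatrix k i j := by
  have h := congrFun (congrFun (transpose_mul_form_mul g) i) j
  rw [← h]
  simp [formMatrix, Matrix.mul_apply, Fin.sum_univ_four]
  ring

theorem mat_inv_eq (g : Sp4 k) :
    mat g⁻¹ = -(formMatrix k) * (mat g).transpose * formMatrix k := by
  have hsq : -formMatrix k * formMatrix k = 1 := by
    ext i j; fin_cases i <;> fin_cases j <;> simp [formMatrix, Matrix.mul_apply, Fin.sum_univ_four]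
  rw [mat_inv]
  refine Matrix.inv_eq_left_inv ?_
  rw [mul_assoc, mul_assoc, ← mul_assoc (mat g).transpose, transpose_mul_form_mul, hsq]

/-- The rows of a symplectic matrix form a symplectic basis. -/
theorem form_rows (g : Sp4 k) (i j : Fin 4) :
    -(mat g i 0 * mat g j 3) - mat g i 1 * mat g j 2 + mat g i 2 * mat g j 1
      + mat g i 3 * mat g j 0 = formMatrix k i j := by
  have h1 : mat g * mat g⁻¹ = 1 := by rw [← mat_mul, mul_inv_cancel, mat_one]
  have hsq : formMatrix k * formMatrix k = -1 := by
    ext i j; fin_cases i <;> fin_cases j <;> simp [formMatrix, Matrix.mul_apply, Fin.sum_univ_four]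
  have h2 : mat g * formMatrix k * (mat g).transpose = formMatrix k := by
    rw [mat_inv_eq] at h1
    have h3 := congrArg (· * formMatrix k) h1
    simp only [neg_mul, mul_neg, mul_assoc, hsq, one_mul, mul_one, neg_neg] at h3
    rw [mul_assoc]; exact h3
  have h := congrFun (congrFun h2 i) j
  rw [← h]
  simp [formMatrix, Matrix.mul_apply, Fin.sum_univ_four]
  ring

theorem mem_lastHalf {v : Fin 4 → k} : v ∈ lastHalf k ↔ v 0 = 0 ∧ v 1 = 0 := by
  rw [lastHalf, Submodule.mem_span_pair]
  constructor
  · rintro ⟨a, b, rfl⟩; simp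
  · rintro ⟨h0, h1⟩
    refine ⟨v 2, v 3, ?_⟩
    ext i; fin_cases i <;> simp [h0, h1]

theorem mem_firstHalf {v : Fin 4 → k} : v ∈ firstHalf k ↔ v 2 = 0 ∧ v 3 = 0 := by
  rw [firstHalf, Submodule.mem_span_pair]
  constructor
  · rintro ⟨a, b, rfl⟩; simp
  · rintro ⟨h0, h1⟩
    refine ⟨v 0, v 1, ?_⟩
    ext i; fin_cases i <;> simp [h0, h1]

theorem mulVecLin_injective (g : Sp4 k) : Function.Injective (mat g).mulVecLin := by
  refine Function.LeftInverse.injective (g := (mat g⁻¹).mulVecLin) fun v => ?_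
  rw [← LinearMap.comp_apply, ← Matrix.mulVecLin_mul, ← mat_mul, inv_mul_cancel, mat_one,
    Matrix.mulVecLin_one, LinearMap.id_apply]

theorem mem_stab_iff {g : Sp4 k} {U : Submodule k (Fin 4 → k)} :
    g ∈ stab k U ↔ ∀ v ∈ U, (mat g).mulVec v ∈ U := by
  constructor
  · intro h v hv
    have h' : U.map (mat g).mulVecLin = U := h
    rw [← h']
    exact Submodule.mem_map_of_mem hv
  · intro h
    change U.map (mat g).mulVecLin = U
    refine Submodule.eq_of_le_of_finrank_eq (Submodule.map_le_iff_le_comap.mpr h) ?_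
    exact (Submodule.equivMapOfInjective _ (mulVecLin_injective g) U).finrank_eq.symm

theorem mem_P_iff {g : Sp4 k} :
    g ∈ P k ↔ mat g 0 2 = 0 ∧ mat g 0 3 = 0 ∧ mat g 1 2 = 0 ∧ mat g 1 3 = 0 := by
  rw [P, mem_stab_iff]
  constructor
  · intro h
    have h2 := mem_lastHalf.mp (h (Pi.single 2 1) (mem_lastHalf.mpr (by simp)))
    have h3 := mem_lastHalf.mp (h (Pi.single 3 1) (mem_lastHalf.mpr (by simp)))
    simp only [Matrix.mulVec_single_one, Matrix.col_apply] at h2 h3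
    exact ⟨h2.1, h3.1, h2.2, h3.2⟩
  · rintro ⟨h1, h2, h3, h4⟩ v hv
    rw [mem_lastHalf] at hv ⊢
    simp [Matrix.mulVec, dotProduct, Fin.sum_univ_four, *]

theorem mem_Q_iff {g : Sp4 k} :
    g ∈ Q k ↔ mat g 2 0 = 0 ∧ mat g 2 1 = 0 ∧ mat g 3 0 = 0 ∧ mat g 3 1 = 0 := by
  rw [Q, mem_stab_iff]
  constructor
  · intro h
    have h2 := mem_firstHalf.mp (h (Pi.single 0 1) (mem_firstHalf.mpr (by simp)))
    have h3 := mem_firstHalf.mp (h (Pi.single 1 1) (mem_firstHalf.mpr (by simp)))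
    simp only [Matrix.mulVec_single_one, Matrix.col_apply] at h2 h3
    exact ⟨h2.1, h3.1, h2.2, h3.2⟩
  · rintro ⟨h1, h2, h3, h4⟩ v hv
    rw [mem_firstHalf] at hv ⊢
    simp [Matrix.mulVec, dotProduct, Fin.sum_univ_four, *]

/-- The upper left `2 × 2` block of a symplectic matrix. -/
def topLeft (g : Sp4 k) : Matrix (Fin 2) (Fin 2) k :=
  !![mat g 0 0, mat g 0 1; mat g 1 0, mat g 1 1]

@[simp]
theorem topLeft_one : topLeft (1 : Sp4 k) = 1 := by
  simp [topLeft, mat_one, Matrix.one_fin_two]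

theorem topLeft_mul_of_mem_P {x : Sp4 k} (hx : x ∈ P k) (g : Sp4 k) :
    topLeft (x * g) = topLeft x * topLeft g := by
  obtain ⟨h1, h2, h3, h4⟩ := mem_P_iff.mp hx
  simp [topLeft, mat_mul, Matrix.mul_apply, Fin.sum_univ_four, *]

theorem topLeft_mul_of_mem_Q (g : Sp4 k) {y : Sp4 k} (hy : y ∈ Q k) :
    topLeft (g * y) = topLeft g * topLeft y := by
  obtain ⟨h1, h2, h3, h4⟩ := mem_Q_iff.mp hy
  simp [topLeft, mat_mul, Matrix.mul_apply, Fin.sum_univ_four, *]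

theorem mem_P_of_mem_RuP {u : Sp4 k} (hu : u ∈ RuP k) : u ∈ P k :=
  mem_stab_iff.mpr fun v hv => by rw [hu.1 v hv]; exact hv

theorem mem_Q_of_mem_RuQ {u : Sp4 k} (hu : u ∈ RuQ k) : u ∈ Q k :=
  mem_stab_iff.mpr fun v hv => by rw [hu.1 v hv]; exact hv

theorem topLeft_of_mem_RuP {u : Sp4 k} (hu : u ∈ RuP k) : topLeft u = 1 := by
  have h0 := mem_lastHalf.mp (hu.2 (Pi.single 0 1))
  have h1 := mem_lastHalf.mp (hu.2 (Pi.single 1 1))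
  simp [sub_eq_zero] at h0 h1
  simp [topLeft, h0, h1, Matrix.one_fin_two]

theorem topLeft_of_mem_RuQ {u : Sp4 k} (hu : u ∈ RuQ k) : topLeft u = 1 := by
  have h0 := hu.1 (Pi.single 0 1) (mem_firstHalf.mpr (by simp))
  have h1 := hu.1 (Pi.single 1 1) (mem_firstHalf.mpr (by simp))
  have a0 := congrFun h0 0
  have a1 := congrFun h0 1
  have b0 := congrFun h1 0
  have b1 := congrFun h1 1
  simp at a0 a1 b0 b1
  simp [topLeft, a0, a1, b0, b1, Matrix.one_fin_two]

theorem one_mem_RuP : (1 : Sp4 k) ∈ RuP k :=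
  ⟨fun v _ => by simp [mat_one], fun v => by simp [mat_one]⟩

theorem one_mem_RuQ : (1 : Sp4 k) ∈ RuQ k :=
  ⟨fun v _ => by simp [mat_one], fun v => by simp [mat_one]⟩

/-- The lower right block of an element of `L` is determined by its upper left block. -/
theorem eq_of_topLeft_eq {l m : L k} (h : topLeft (l : Sp4 k) = topLeft (m : Sp4 k)) :
    l = m := by
  have hlm : topLeft ((l⁻¹ * m : L k) : Sp4 k) = 1 := by
    rw [Subgroup.coe_mul, topLeft_mul_of_mem_P (l⁻¹).2.1, ← h, ← topLeft_mul_of_mem_P (l⁻¹).2.1,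
      ← Subgroup.coe_mul, inv_mul_cancel, Subgroup.coe_one, topLeft_one]
  refine (inv_mul_eq_one.mp ?_)
  set x : L k := l⁻¹ * m
  obtain ⟨p1, p2, p3, p4⟩ := mem_P_iff.mp x.2.1
  obtain ⟨q1, q2, q3, q4⟩ := mem_Q_iff.mp x.2.2
  have e00 := congrFun (congrFun hlm 0) 0
  have e01 := congrFun (congrFun hlm 0) 1
  have e10 := congrFun (congrFun hlm 1) 0
  have e11 := congrFun (congrFun hlm 1) 1
  simp [topLeft] at e00 e01 e10 e11
  have f1 := form_columns (x : Sp4 k) 0 2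
  have f2 := form_columns (x : Sp4 k) 0 3
  have f3 := form_columns (x : Sp4 k) 1 2
  have f4 := form_columns (x : Sp4 k) 1 3
  simp [formMatrix, *] at f1 f2 f3 f4
  refine Subtype.ext (mat_injective ?_)
  ext i j
  fin_cases i <;> fin_cases j <;> simp [mat_one, *]

theorem topLeft_of_isLeviComponent_RuP {x : Sp4 k} {l : L k}
    (h : IsLeviComponent (RuP k) x l) : topLeft x = topLeft (l : Sp4 k) := by
  obtain ⟨u, hu, rfl⟩ := h
  rw [topLeft_mul_of_mem_P (mem_P_of_mem_RuP hu), topLeft_of_mem_RuP hu, one_mul]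

theorem topLeft_of_isLeviComponent_RuQ {x : Sp4 k} {l : L k}
    (h : IsLeviComponent (RuQ k) x l) : topLeft x = topLeft (l : Sp4 k) := by
  obtain ⟨u, hu, rfl⟩ := h
  rw [topLeft_mul_of_mem_Q _ l.2.2, topLeft_of_mem_RuQ hu, one_mul]

/-- The element of `L` with upper left block `A`, whose lower right block is `J ᵗA⁻¹ J`. -/
def levi (A : Matrix (Fin 2) (Fin 2) k) (hA : A.det ≠ 0) : L k :=
  ⟨ofMatrix !![A 0 0, A 0 1, 0, 0; A 1 0, A 1 1, 0, 0;
      0, 0, A 0 0 / A.det, -A 0 1 / A.det; 0, 0, -A 1 0 / A.det, A 1 1 / A.det] (by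
    have h : A 0 0 * A 1 1 - A 0 1 * A 1 0 = A.det := (Matrix.det_fin_two A).symm
    ext i j
    fin_cases i <;> fin_cases j <;>
      simp [formMatrix, Matrix.mul_apply, Fin.sum_univ_four] <;> field_simp <;>
      first | ring1 | linear_combination h | linear_combination -h),
    mem_P_iff.mpr (by simp), mem_Q_iff.mpr (by simp)⟩

@[simp]
theorem topLeft_levi (A : Matrix (Fin 2) (Fin 2) k) (hA : A.det ≠ 0) :
    topLeft (levi A hA : Sp4 k) = A := by
  simp [topLeft, levi, ← Matrix.eta_fin_two]

/-- The element of `R_u(P)` with lower left block `!![x, y; z, x]`. -/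
def lowerUnipotent (x y z : k) : Sp4 k :=
  ofMatrix !![1, 0, 0, 0; 0, 1, 0, 0; x, y, 1, 0; z, x, 0, 1] (by
    ext i j
    fin_cases i <;> fin_cases j <;>
      simp [formMatrix, Matrix.mul_apply, Fin.sum_univ_four])

theorem lowerUnipotent_mem_RuP (x y z : k) : lowerUnipotent x y z ∈ RuP k := by
  constructor
  · intro v hv
    obtain ⟨h0, h1⟩ := mem_lastHalf.mp hv
    ext i
    fin_cases i <;>
      simp [lowerUnipotent, Matrix.mulVec, dotProduct, Fin.sum_univ_four, h0, h1]
  · intro v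
    rw [mem_lastHalf]
    simp [lowerUnipotent, dotProduct, Fin.sum_univ_four]

/-- A symplectic matrix whose first two columns are the first two basis vectors is in `R_u(Q)`. -/
theorem mem_RuQ_of_columns {v : Sp4 k} (hv : v ∈ Q k) (h : topLeft v = 1) : v ∈ RuQ k := by
  obtain ⟨q1, q2, q3, q4⟩ := mem_Q_iff.mp hv
  have e00 := congrFun (congrFun h 0) 0
  have e01 := congrFun (congrFun h 0) 1
  have e10 := congrFun (congrFun h 1) 0
  have e11 := congrFun (congrFun h 1) 1
  simp [topLeft] at e00 e01 e10 e11
  have f1 := form_columns v 0 2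
  have f2 := form_columns v 0 3
  have f3 := form_columns v 1 2
  have f4 := form_columns v 1 3
  simp [formMatrix, *] at f1 f2 f3 f4
  constructor
  · intro w hw
    obtain ⟨h0, h1⟩ := mem_firstHalf.mp hw
    ext i
    fin_cases i <;> simp [Matrix.mulVec, dotProduct, Fin.sum_univ_four, *]
  · intro w
    rw [mem_firstHalf]
    simp [Matrix.mulVec, dotProduct, Fin.sum_univ_four, *]

/-- The big cell: a symplectic matrix with invertible upper left block `A` lies in
`R_u(P) l R_u(Q)`, where `l` is the element of `L` with block `A`. -/
theorem exists_eq_mul_levi_mul (g : Sp4 k) (hg : (topLeft g).det ≠ 0) :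
    ∃ u ∈ RuP k, ∃ v ∈ RuQ k, g = u * (levi (topLeft g) hg : Sp4 k) * v := by
  set δ := (topLeft g).det with hδ
  have hdet : mat g 0 0 * mat g 1 1 - mat g 0 1 * mat g 1 0 = δ := by
    rw [hδ, Matrix.det_fin_two]; simp [topLeft]
  have hform := form_columns g 0 1
  simp [formMatrix] at hform
  -- The lower left block of `u` is `C A⁻¹`; the isotropy of the columns makes it symmetric.
  set x := (mat g 2 0 * mat g 1 1 - mat g 2 1 * mat g 1 0) / δ with hx
  set y := (mat g 2 1 * mat g 0 0 - mat g 2 0 * mat g 0 1) / δ with hy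
  set z := (mat g 3 0 * mat g 1 1 - mat g 3 1 * mat g 1 0) / δ with hz
  have r1 : mat g 2 0 = x * mat g 0 0 + y * mat g 1 0 := by
    rw [hx, hy]; field_simp; linear_combination (-mat g 2 0) * hdet
  have r2 : mat g 2 1 = x * mat g 0 1 + y * mat g 1 1 := by
    rw [hx, hy]; field_simp; linear_combination (-mat g 2 1) * hdet
  have r3 : mat g 3 0 = z * mat g 0 0 + x * mat g 1 0 := by
    rw [hx, hz]; field_simp
    linear_combination (-mat g 3 0) * hdet - mat g 1 0 * hform
  have r4 : mat g 3 1 = z * mat g 0 1 + x * mat g 1 1 := by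
    rw [hx, hz]; field_simp
    linear_combination (-mat g 3 1) * hdet - mat g 1 1 * hform
  set u := lowerUnipotent x y z with hu
  have huP : u ∈ RuP k := lowerUnipotent_mem_RuP x y z
  set l := levi (topLeft g) hg with hl
  have hw : u⁻¹ * g ∈ Q k := by
    have : u⁻¹ = lowerUnipotent (-x) (-y) (-z) := by
      rw [inv_eq_iff_mul_eq_one]
      refine mat_injective ?_
      ext i j
      fin_cases i <;> fin_cases j <;>
        simp [hu, lowerUnipotent, mat_mul, Matrix.mul_apply, Fin.sum_univ_four, mat_one]
    rw [this, mem_Q_iff]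
    simp only [mat_mul, Matrix.mul_apply, Fin.sum_univ_four, lowerUnipotent, mat_ofMatrix]
    simp only [r1, r2, r3, r4]
    refine ⟨?_, ?_, ?_, ?_⟩ <;> simp <;> ring
  have hwt : topLeft (u⁻¹ * g) = topLeft g := by
    have h1 : topLeft (u * (u⁻¹ * g)) = topLeft (u⁻¹ * g) := by
      rw [topLeft_mul_of_mem_P (mem_P_of_mem_RuP huP), topLeft_of_mem_RuP huP, one_mul]
    rw [← h1, mul_inv_cancel_left]
  refine ⟨u, huP, (l : Sp4 k)⁻¹ * (u⁻¹ * g), mem_RuQ_of_columns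
    ((Q k).mul_mem ((Q k).inv_mem l.2.2) hw) ?_, by group⟩
  rw [topLeft_mul_of_mem_P ((P k).inv_mem l.2.1), hwt]
  have h1 : topLeft ((l : Sp4 k)⁻¹ * (l : Sp4 k)) = 1 := by rw [inv_mul_cancel, topLeft_one]
  rwa [topLeft_mul_of_mem_P ((P k).inv_mem l.2.1), hl, topLeft_levi] at h1

end Coordinates

section Frobenius

variable (p : ℕ) [Fact p.Prime] {k : Type*} [Field k] [Algebra (ZMod p) k]

theorem mat_frobSp4 (g : Sp4 k) : mat (frobSp4 p k g) = (mat g).map (frob p k) := rfl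

theorem topLeft_frobSp4 (g : Sp4 k) : topLeft (frobSp4 p k g) = (topLeft g).map (frob p k) := by
  ext i j; fin_cases i <;> fin_cases j <;> simp [topLeft, mat_frobSp4]

theorem frobSp4_mem_L (l : L k) : frobSp4 p k (l : Sp4 k) ∈ L k := by
  obtain ⟨p1, p2, p3, p4⟩ := mem_P_iff.mp l.2.1
  obtain ⟨q1, q2, q3, q4⟩ := mem_Q_iff.mp l.2.2
  exact ⟨mem_P_iff.mpr (by simp [mat_frobSp4, *]), mem_Q_iff.mpr (by simp [mat_frobSp4, *])⟩

end Frobenius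

/-! ### Weights of nonzero sections -/

section Weights

variable (p : ℕ) [Fact p.Prime] {k : Type*} [Field k] [Algebra (ZMod p) k]

/-- `h` is a regular function on `Sp(4)`, invariant under `R_u(P)` on the left and `R_u(Q)` on
the right, and semi-invariant of weight `lam` for twisted conjugation by `B_L`. The evaluation at
`1` of a section of `V(lam)` has these properties. -/
structure IsSemiinvariant (lam : ℤ × ℤ) (h : Sp4 k → k) : Prop where
  regular : ∃ H : MvPolynomial (Fin 4 × Fin 4) k, ∀ g, h g = H.eval fun ij => mat g ij.1 ij.2
  left_inv : ∀ u ∈ RuP k, ∀ g, h (u * g) = h g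
  right_inv : ∀ v ∈ RuQ k, ∀ g, h (g * v) = h g
  twisted : ∀ b : L k, (b : Sp4 k) ∈ B k → ∀ g,
    h ((b : Sp4 k) * g * (frobSp4 p k (b : Sp4 k))⁻¹) = charValue lam (b : Sp4 k) * h g

variable {p}

theorem frobSp4_mem_zipGroup (l : L k) : ((l : Sp4 k), frobSp4 p k (l : Sp4 k)) ∈ zipGroup p k :=
  ⟨l.2.1, (frobSp4_mem_L p l).2, l, ⟨_, frobSp4_mem_L p l⟩, ⟨1, one_mem_RuP, by simp⟩,
    ⟨1, one_mem_RuQ, by simp⟩, rfl⟩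

theorem charValue_inv {lam : ℤ × ℤ} {b : L k} (hb : (b : Sp4 k) ∈ B k) :
    (charValue lam (b : Sp4 k)⁻¹)⁻¹ = charValue lam (b : Sp4 k) := by
  have hb' : (b : Sp4 k)⁻¹ ∈ B k := (B k).inv_mem hb
  have h1 : mat (b : Sp4 k)⁻¹ * mat (b : Sp4 k) = 1 := by
    rw [← mat_mul, inv_mul_cancel, mat_one]
  obtain ⟨p1, p2, p3, p4⟩ := mem_P_iff.mp ((P k).inv_mem b.2.1)
  have hz : mat (b : Sp4 k)⁻¹ 0 1 = 0 := hb' (by decide)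
  have hz' : mat (b : Sp4 k) 0 1 = 0 := hb (by decide)
  have h00 := congrFun (congrFun h1 0) 0
  have h11 := congrFun (congrFun h1 1) 1
  simp [Matrix.mul_apply, Fin.sum_univ_four, *] at h00 h11
  rw [charValue, charValue, eq_inv_of_mul_eq_one_left h00, eq_inv_of_mul_eq_one_left h11]
  simp [mul_comm]

/-- A nonzero section yields a nonzero semi-invariant by evaluation at `1 ∈ L`. -/
theorem exists_isSemiinvariant {lam : ℤ × ℤ} (hlam : lam ∈ Czip k p) :
    ∃ h : Sp4 k → k, IsSemiinvariant p lam h ∧ ∃ g, h g ≠ 0 := by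
  obtain ⟨F, hF, hF0⟩ := Submodule.exists_mem_ne_zero_of_ne_bot hlam
  obtain ⟨hreg, hF⟩ := hF
  have hL : ∀ (l : L k) (g : Sp4 k) (x : L k),
      (F ((l : Sp4 k) * g * (frobSp4 p k (l : Sp4 k))⁻¹)).1 x = (F g).1 (l⁻¹ * x) := by
    intro l g x
    rw [hF _ (frobSp4_mem_zipGroup l) l ⟨1, one_mem_RuP, by simp⟩ g]
    rfl
  refine ⟨fun g => (F g).1 1, ⟨?_, fun u hu g => ?_, fun v hv g => ?_, fun b hb g => ?_⟩, ?_⟩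
  · clear hF hF0 hL
    induction hreg using Submodule.span_induction with
    | mem F hF =>
      obtain ⟨f, ⟨H, hH⟩, v, rfl⟩ := hF
      exact ⟨H * MvPolynomial.C (v.1 1), fun g => by simp [hH]⟩
    | zero => exact ⟨0, by simp⟩
    | add F F' _ _ h h' =>
      obtain ⟨H, hH⟩ := h
      obtain ⟨H', hH'⟩ := h'
      exact ⟨H + H', fun g => by simp [hH, hH']⟩
    | smul c F _ h =>
      obtain ⟨H, hH⟩ := h
      exact ⟨MvPolynomial.C c * H, fun g => by simp [hH]⟩
  · have := hF (u, 1) ⟨mem_P_of_mem_RuP hu, (Q k).one_mem, 1, 1, ⟨u, hu, by simp⟩,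
      ⟨1, one_mem_RuQ, by simp⟩, by simp⟩ 1 ⟨u, hu, by simp⟩ g
    simp only [inv_one, mul_one, map_one, Module.End.one_apply] at this
    rw [this]
  · have := hF (1, v) ⟨(P k).one_mem, mem_Q_of_mem_RuQ hv, 1, 1, ⟨1, one_mem_RuP, by simp⟩,
      ⟨v, hv, by simp⟩, by simp⟩ 1 ⟨1, one_mem_RuP, by simp⟩ (g * v)
    simp only [one_mul, mul_inv_cancel_right, map_one, Module.End.one_apply] at this
    rw [this]
  · have hb' : ((b⁻¹ : L k) : Sp4 k) ∈ B k := (B k).inv_mem hb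
    change (F _).1 1 = _ * (F g).1 1
    rw [hL, mul_one, ← one_mul b⁻¹, (F g).2.2 1 b⁻¹ hb', Subgroup.coe_inv, charValue_inv hb]
  · by_contra! h
    refine hF0 (funext fun g => Subtype.ext (funext fun l => ?_))
    have := hL l⁻¹ g 1
    rw [inv_inv, mul_one, h] at this
    exact this.symm

/-- The slice through the open set where the upper right entry `b` of the upper left block does
not vanish: every twisted conjugacy class under `B_L` in that set meets the blocks
`!![e, 1; c, 0]`. -/
def slice (e c : k) : Sp4 k :=
  ofMatrix !![e, 1, 0, 0; c, 0, e, -1; 1, 0, 0, 0; 0, 0, 1, 0] (by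
    ext i j
    fin_cases i <;> fin_cases j <;> simp [formMatrix, Matrix.mul_apply, Fin.sum_univ_four])

theorem topLeft_slice (e c : k) : topLeft (slice e c) = !![e, 1; c, 0] := by
  simp [topLeft, slice]

/-- Every Lagrangian subspace has a complement among the translates of the standard one by
`R_u(P)`: if all candidates failed, then all `2 × 2` minors of the first two rows of `g` would
vanish, by the Plücker relation and the isotropy of the rows. -/
theorem exists_det_topLeft_mul_ne_zero (g : Sp4 k) :
    ∃ x y z : k, (topLeft (g * lowerUnipotent x y z)).det ≠ 0 := by
  by_contra! h
  have h1 := h 0 0 0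
  have h2 := h 0 1 0
  have h3 := h 0 0 1
  have h4 := h 0 1 1
  have h5 := h 1 0 0
  simp [topLeft, lowerUnipotent, mat_mul, Matrix.mul_apply, Fin.sum_univ_four,
    Matrix.det_fin_two] at h1 h2 h3 h4 h5
  have hr := form_rows g 0 1
  simp [formMatrix] at hr
  have m01 : mat g 0 0 * mat g 1 1 - mat g 0 1 * mat g 1 0 = 0 := h1
  have m02 : mat g 0 0 * mat g 1 2 - mat g 0 2 * mat g 1 0 = 0 := by
    linear_combination h2 - h1
  have m13 : mat g 0 1 * mat g 1 3 - mat g 0 3 * mat g 1 1 = 0 := by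
    linear_combination h1 - h3
  have m23 : mat g 0 2 * mat g 1 3 - mat g 0 3 * mat g 1 2 = 0 := by
    linear_combination h2 + h3 - h1 - h4
  have m0312 : mat g 0 0 * mat g 1 3 - mat g 0 3 * mat g 1 0 =
      mat g 0 1 * mat g 1 2 - mat g 0 2 * mat g 1 1 := by
    linear_combination h5 - m23 - m01
  have m03 : mat g 0 0 * mat g 1 3 - mat g 0 3 * mat g 1 0 = 0 := by
    have : (mat g 0 0 * mat g 1 3 - mat g 0 3 * mat g 1 0) *
        (mat g 0 0 * mat g 1 3 - mat g 0 3 * mat g 1 0) = 0 := by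
      nth_rewrite 2 [m0312]
      linear_combination m02 * (mat g 0 1 * mat g 1 3 - mat g 0 3 * mat g 1 1) -
        m01 * (mat g 0 2 * mat g 1 3 - mat g 0 3 * mat g 1 2)
    exact mul_self_eq_zero.mp this
  have m12 : mat g 0 1 * mat g 1 2 - mat g 0 2 * mat g 1 1 = 0 := m0312 ▸ m03
  have r02 := form_rows g 0 2
  have r12 := form_rows g 1 2
  have r03 := form_rows g 0 3
  simp [formMatrix] at r02 r12 r03
  have z0 : mat g 0 0 = 0 := by
    linear_combination mat g 0 0 * r12 - mat g 1 0 * r02 + m01 * mat g 2 2 - m02 * mat g 2 1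
      - m03 * mat g 2 0
  have z1 : mat g 0 1 = 0 := by
    linear_combination mat g 0 1 * r12 - mat g 1 1 * r02 - m01 * mat g 2 3 - m12 * mat g 2 1
      - m13 * mat g 2 0
  have z2 : mat g 0 2 = 0 := by
    linear_combination mat g 0 2 * r12 - mat g 1 2 * r02 - m02 * mat g 2 3 - m12 * mat g 2 2
      - m23 * mat g 2 0
  have z3 : mat g 0 3 = 0 := by
    linear_combination mat g 0 3 * r12 - mat g 1 3 * r02 - m03 * mat g 2 3 - m13 * mat g 2 2
      + m23 * mat g 2 1
  simp [z0, z1, z2, z3] at r03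

namespace IsSemiinvariant

variable {lam : ℤ × ℤ} {h : Sp4 k → k}

/-- A semi-invariant is a polynomial along every polynomial family in `Sp(4)`. -/
theorem exists_eq_along (hs : IsSemiinvariant p lam h) {R : Type*} [CommRing R] [Algebra k R]
    (Γ : Matrix (Fin 4) (Fin 4) R) :
    ∃ q : R, ∀ ε : R →ₐ[k] k, ∀ g : Sp4 k, mat g = Γ.map ε → h g = ε q := by
  obtain ⟨H, hH⟩ := hs.regular
  refine ⟨MvPolynomial.aeval (fun ij : Fin 4 × Fin 4 => Γ ij.1 ij.2) H, fun ε g hg => ?_⟩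
  rw [hH, ← AlgHom.comp_apply, MvPolynomial.comp_aeval, hg, ← MvPolynomial.coe_aeval_eq_eval]
  rfl

theorem eq_levi (hs : IsSemiinvariant p lam h) {g : Sp4 k} {A : Matrix (Fin 2) (Fin 2) k}
    (hg : topLeft g = A) (hA : A.det ≠ 0) : h g = h (levi A hA : Sp4 k) := by
  subst hg
  obtain ⟨u, hu, v, hv, e⟩ := exists_eq_mul_levi_mul g hA
  conv_lhs => rw [e]
  rw [hs.right_inv v hv, hs.left_inv u hu]

/-- The semi-invariance in terms of `2 × 2` blocks. -/
theorem levi_eq (hs : IsSemiinvariant p lam h) {b A A' : Matrix (Fin 2) (Fin 2) k}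
    (hA : A.det ≠ 0) (hA' : A'.det ≠ 0) (h01 : b 0 1 = 0) (h00 : b 0 0 ≠ 0) (h11 : b 1 1 ≠ 0)
    (e : b * A = A' * b.map (frob p k)) :
    h (levi A' hA' : Sp4 k) = b 0 0 ^ lam.1 * b 1 1 ^ lam.2 * h (levi A hA : Sp4 k) := by
  have hb : b.det ≠ 0 := by simp [Matrix.det_fin_two, h01, h00, h11]
  have hbB : ((levi b hb : L k) : Sp4 k) ∈ B k := by
    intro i j hij
    change j > i at hij
    fin_cases i <;> fin_cases j <;> simp at hij <;> simp [levi, h01]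
  have key : levi b hb * levi A hA =
      levi A' hA' * ⟨frobSp4 p k (levi b hb : Sp4 k), frobSp4_mem_L p _⟩ := by
    apply eq_of_topLeft_eq
    rw [Subgroup.coe_mul, Subgroup.coe_mul, topLeft_mul_of_mem_P (levi b hb).2.1,
      topLeft_mul_of_mem_P (levi A' hA').2.1, topLeft_frobSp4]
    simpa using e
  have key' := congrArg (Subtype.val : L k → Sp4 k) key
  simp only [Subgroup.coe_mul] at key'
  have := hs.twisted (levi b hb) hbB (levi A hA : Sp4 k)
  rw [key', mul_inv_cancel_right] at this
  rw [this]
  simp [charValue, levi]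

/-- Reduction to the slice, by the matrix `!![1 / b, 0; -d / b, 1]`. -/
theorem levi_eq_slice (hs : IsSemiinvariant p lam h) {A : Matrix (Fin 2) (Fin 2) k}
    (hA : A.det ≠ 0) (hb : A 0 1 ≠ 0) :
    h (levi A hA : Sp4 k) = A 0 1 ^ lam.1 *
      h (slice (A 1 1 ^ p + A 0 0 * A 0 1 ^ (p - 1)) (-(A 0 1 ^ (p - 1) * A.det))) := by
  have hp := (Fact.out : p.Prime)
  set e := A 1 1 ^ p + A 0 0 * A 0 1 ^ (p - 1) with he
  set c := -(A 0 1 ^ (p - 1) * A.det) with hc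
  have hA' : (!![e, 1; c, 0]).det ≠ 0 := by
    rw [Matrix.det_fin_two_of, mul_zero, one_mul, zero_sub, hc, neg_neg]
    exact mul_ne_zero (pow_ne_zero _ hb) hA
  rw [hs.eq_levi (topLeft_slice e c) hA']
  have hpow : A 0 1 ^ p = A 0 1 ^ (p - 1) * A 0 1 := (pow_sub_one_mul hp.ne_zero _).symm
  rw [hs.levi_eq (b := !![(A 0 1)⁻¹, 0; -A 1 1 * (A 0 1)⁻¹, 1]) hA hA' (by simp) (by simpa)
    (by simp)]
  · simp [← mul_assoc, mul_inv_cancel₀ (zpow_ne_zero lam.1 hb)]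
  · rw [Matrix.det_fin_two] at hc
    have hm : (!![(A 0 1)⁻¹, 0; -A 1 1 * (A 0 1)⁻¹, 1]).map (frob p k) =
        !![(A 0 1 ^ p)⁻¹, 0; -A 1 1 ^ p * (A 0 1 ^ p)⁻¹, 1] := by
      ext i j
      fin_cases i <;> fin_cases j <;> simp only [Matrix.map_apply] <;>
        simp [map_neg, map_mul, map_inv₀, frob_apply, hp.ne_zero, -neg_mul]
    rw [hm, hpow]
    ext i j
    have hb' : A 0 1 ^ (p - 1) ≠ 0 := pow_ne_zero _ hb
    generalize A 0 1 ^ (p - 1) = B at *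
    generalize A 1 1 ^ p = D at *
    fin_cases i <;> fin_cases j <;> simp [Matrix.mul_apply, he, hc, hb] <;> field_simp <;> ring

theorem exists_slice_ne_zero [Infinite k] (hs : IsSemiinvariant p lam h) (hne : ∃ g, h g ≠ 0) :
    ∃ e c, h (slice e c) ≠ 0 := by
  by_contra! h0
  obtain ⟨g, hg⟩ := hne
  have h1 : ∀ A : Matrix (Fin 2) (Fin 2) k, ∀ hA : A.det ≠ 0, A 0 1 ≠ 0 →
      h (levi A hA : Sp4 k) = 0 := fun A hA hb => by
    rw [hs.levi_eq_slice hA hb, h0, mul_zero]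
  -- The locus `b = 0` in `L` is reached along the curve `A * !![1, t; 0, 1]`.
  have h2 : ∀ A : Matrix (Fin 2) (Fin 2) k, ∀ hA : A.det ≠ 0, h (levi A hA : Sp4 k) = 0 := by
    intro A hA
    by_cases hb : A 0 1 = 0
    swap
    · exact h1 A hA hb
    have ha : A 0 0 ≠ 0 := fun ha => hA (by simp [Matrix.det_fin_two, ha, hb])
    obtain ⟨q, hq⟩ := hs.exists_eq_along (R := Polynomial k)
      ((mat (levi A hA : Sp4 k)).map Polynomial.C *
        !![1, Polynomial.X, 0, 0; 0, 1, 0, 0; 0, 0, 1, -Polynomial.X; 0, 0, 0, 1])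
    have hU : ∀ t : k, (!![(1 : k), t; 0, 1]).det ≠ 0 := fun t => by simp [Matrix.det_fin_two]
    have hAU : ∀ t : k, (A * !![(1 : k), t; 0, 1]).det ≠ 0 := fun t => by
      rw [Matrix.det_mul]; exact mul_ne_zero hA (hU t)
    have hq' : ∀ t, q.eval t = h (levi _ (hAU t) : Sp4 k) := by
      intro t
      have hprod : levi _ (hAU t) = levi A hA * levi _ (hU t) := by
        apply eq_of_topLeft_eq
        rw [Subgroup.coe_mul, topLeft_mul_of_mem_P (levi A hA).2.1]
        simp
      rw [hprod, ← Polynomial.coe_aeval_eq_eval]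
      refine (hq (Polynomial.aeval t) _ ?_).symm
      rw [Subgroup.coe_mul, mat_mul, Matrix.map_mul]
      congr 1
      · ext i j; simp
      · ext i j
        fin_cases i <;> fin_cases j <;> simp [levi]
    have hq0 : q = 0 := by
      refine Polynomial.eq_zero_of_infinite_isRoot q ?_
      refine Set.Infinite.mono (s := {0}ᶜ) (fun t ht => ?_) (Set.finite_singleton _).infinite_compl
      rw [Set.mem_ofPred_eq, Polynomial.IsRoot, hq' t]
      exact h1 _ _ (by simpa [Matrix.mul_apply, hb, ha] using ht)
    have := hq' 0
    rw [hq0, Polynomial.eval_zero] at this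
    rw [this]
    congr 3
    simp [← Matrix.one_fin_two]
  obtain ⟨x, y, z, hxyz⟩ := exists_det_topLeft_mul_ne_zero g
  let Γ : Matrix (Fin 4) (Fin 4) (Polynomial k) := (mat g).map Polynomial.C *
    !![1, 0, 0, 0; 0, 1, 0, 0; Polynomial.C x * Polynomial.X, Polynomial.C y * Polynomial.X, 1, 0;
      Polynomial.C z * Polynomial.X, Polynomial.C x * Polynomial.X, 0, 1]
  have hΓ : ∀ t : k, mat (g * lowerUnipotent (x * t) (y * t) (z * t)) =
      Γ.map (Polynomial.aeval t) := by
    intro t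
    rw [mat_mul, Matrix.map_mul]
    congr 1
    · ext i j; simp
    · ext i j
      fin_cases i <;> fin_cases j <;> simp [lowerUnipotent]
  obtain ⟨q, hq⟩ := hs.exists_eq_along Γ
  let r : Polynomial k := Γ 0 0 * Γ 1 1 - Γ 0 1 * Γ 1 0
  have hr : ∀ t : k, r.eval t = (topLeft (g * lowerUnipotent (x * t) (y * t) (z * t))).det := by
    intro t
    simp [topLeft, hΓ, r, Matrix.det_fin_two]
  have hqr : q * r = 0 := by
    refine Polynomial.funext fun t => ?_
    rw [Polynomial.eval_mul, Polynomial.eval_zero]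
    by_cases hrt : r.eval t = 0
    · rw [hrt, mul_zero]
    · have := hq (Polynomial.aeval t) _ (hΓ t)
      rw [hs.eq_levi rfl (hr t ▸ hrt), h2, Polynomial.coe_aeval_eq_eval] at this
      rw [← this, zero_mul]
  have hr0 : r ≠ 0 := fun h0 => hxyz (by simpa [h0] using (hr 1).symm)
  have hq0 : q = 0 := (mul_eq_zero.mp hqr).resolve_right hr0
  apply hg
  have hg1 : g * lowerUnipotent (x * 0) (y * 0) (z * 0) = g := by
    have : lowerUnipotent (0 : k) 0 0 = 1 := by
      refine mat_injective ?_
      ext i j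
      fin_cases i <;> fin_cases j <;> simp [lowerUnipotent, mat_one]
    simp [this]
  have := hq (Polynomial.aeval 0) _ (hΓ 0)
  rwa [hg1, hq0, map_zero] at this



theorem exists_slice_polynomial (hs : IsSemiinvariant p lam h) :
    ∃ Φ : Polynomial (Polynomial k), ∀ e c, h (slice e c) = Φ.evalEval e c := by
  obtain ⟨Φ, hΦ⟩ := hs.exists_eq_along (R := Polynomial (Polynomial k))
    !![Polynomial.C Polynomial.X, 1, 0, 0; Polynomial.X, 0, Polynomial.C Polynomial.X, -1;
      1, 0, 0, 0; 0, 0, 1, 0]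
  refine ⟨Φ, fun e c => ?_⟩
  rw [← Polynomial.coe_aevalAeval_eq_evalEval]
  refine hΦ _ _ ?_
  ext i j
  fin_cases i <;> fin_cases j <;> simp [slice]

/-- The torus elements with entries `(y ^ p)⁻¹`, `y⁻¹` preserve the slice. -/
theorem slice_torus (hs : IsSemiinvariant p lam h) {y : k} (hy : y ≠ 0) (e : k) {c : k}
    (hc : c ≠ 0) :
    h (slice (y ^ (p * (p - 1)) * e) (y ^ ((p + 1) * (p - 1)) * c)) =
      y ^ (-(p * lam.1 + lam.2)) * h (slice e c) := by
  have hp := (Fact.out : p.Prime)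
  obtain ⟨q, hq⟩ : ∃ q, p = q + 1 := ⟨p - 1, by have := hp.one_lt; omega⟩
  have hpq : p - 1 = q := by omega
  have hA : (!![e, 1; c, 0]).det ≠ 0 := by simpa [Matrix.det_fin_two] using hc
  have hA' : (!![y ^ (p * (p - 1)) * e, 1; y ^ ((p + 1) * (p - 1)) * c, 0]).det ≠ 0 := by
    simp [Matrix.det_fin_two, hc, hy]
  rw [hs.eq_levi (topLeft_slice _ _) hA', hs.eq_levi (topLeft_slice _ _) hA,
    hs.levi_eq (b := !![(y ^ p)⁻¹, 0; 0, y⁻¹]) hA hA' (by simp) (by simp [hy]) (by simp [hy])]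
  · congr 1
    have e1 : (y ^ p)⁻¹ = y ^ (-(p : ℤ)) := by rw [zpow_neg, zpow_natCast]
    have e2 : y⁻¹ = y ^ (-1 : ℤ) := by rw [zpow_neg_one]
    simp only [Matrix.of_apply, Matrix.cons_val', Matrix.cons_val_zero, Matrix.cons_val_one,
      Matrix.cons_val_fin_one]
    rw [e1, e2, ← zpow_mul, ← zpow_mul, ← zpow_add₀ hy]
    congr 1
    ring
  · have hm : (!![(y ^ p)⁻¹, 0; 0, y⁻¹]).map (frob p k) = !![((y ^ p) ^ p)⁻¹, 0; 0, (y ^ p)⁻¹] := by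
      ext i j
      fin_cases i <;> fin_cases j <;> simp only [Matrix.map_apply] <;>
        simp [map_inv₀, frob_apply, hp.ne_zero]
    rw [hm, hpq]
    have x1 : (y ^ p) ^ p = y ^ p * y ^ (p * q) := by
      rw [← pow_mul, ← pow_add]; congr 1; rw [hq]; ring
    have x2 : (y ^ p) ^ p = y * y ^ ((p + 1) * q) := by
      rw [← pow_mul, ← pow_succ']; congr 1; rw [hq]; ring
    ext i j
    fin_cases i <;> fin_cases j <;> simp [Matrix.mul_apply]
    · rw [x1]; field_simp
    · rw [x2]; field_simp

end IsSemiinvariant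

open Polynomial in
/-- A nonzero polynomial in `e` with `q (y ^ n e) = y ^ M q (e)` for all `y ≠ 0` is a multiple of
`e ^ i` with `n i = M`. -/
theorem exists_mul_eq_of_quasihomogeneous [Infinite k] {q : k[X]} (hq : q ≠ 0) {n : ℕ} (hn : n ≠ 0)
    {M : ℤ} (h : ∀ y : k, y ≠ 0 → ∀ e, q.eval (y ^ n * e) = y ^ M * q.eval e) :
    q.eval 1 ≠ 0 ∧ ∃ i : ℕ, (n : ℤ) * i = M := by
  have key : ∀ i, q.coeff i ≠ 0 → (n : ℤ) * i = M := by
    intro i hi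
    have h1 : ∀ y : k, y ≠ 0 → y ^ ((n : ℤ) * i - M) = 1 := by
      intro y hy
      have hpoly : q.comp (C (y ^ n) * X) = C (y ^ M) * q := Polynomial.funext fun e => by
        simpa using h y hy e
      have hc := congrArg (coeff · i) hpoly
      simp only [comp_C_mul_X_coeff, coeff_C_mul] at hc
      rw [mul_comm] at hc
      have hc := mul_right_cancel₀ hi hc
      rw [zpow_sub₀ hy, ← hc, ← pow_mul, ← Nat.cast_mul, zpow_natCast,
        div_self (pow_ne_zero _ hy)]
    by_contra hne
    set N := ((n : ℤ) * i - M).natAbs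
    have hN : N ≠ 0 := Int.natAbs_ne_zero.mpr (sub_ne_zero.mpr hne)
    have h2 : (X ^ N - 1 : k[X]) = 0 := by
      refine eq_zero_of_infinite_isRoot _ (Set.Infinite.mono (s := {0}ᶜ) (fun y hy => ?_)
        (Set.finite_singleton _).infinite_compl)
      have hy' : y ^ N = 1 := by
        rcases Int.natAbs_eq ((n : ℤ) * i - M) with h' | h'
        · rw [← zpow_natCast, ← h', h1 y hy]
        · rw [← zpow_natCast, ← neg_neg (N : ℤ), ← h', zpow_neg, h1 y hy, inv_one]
      simp [hy']
    exact (monic_X_pow_sub_C (1 : k) hN).ne_zero (by simpa using h2)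
  obtain ⟨i, hi⟩ : ∃ i, q.coeff i ≠ 0 := by
    by_contra! h0
    exact hq (Polynomial.ext h0)
  refine ⟨?_, i, key i hi⟩
  have hmon : q = monomial i (q.coeff i) := by
    ext j
    rw [coeff_monomial]
    split_ifs with hij
    · rw [hij]
    · by_contra hj
      have := (key i hi).trans (key j hj).symm
      have := mul_left_cancel₀ (Nat.cast_ne_zero.mpr hn) this
      exact hij (by exact_mod_cast this)
  rw [hmon]
  simpa using hi

namespace IsSemiinvariant

variable {lam : ℤ × ℤ} {h : Sp4 k → k}

open Polynomial in
/-- The weight of a nonzero semi-invariant is a combination of the weights of the three basic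
ones. The exponent of `det` is the order `l` of vanishing on the slice along `c = 0`. The lowest
coefficient there is a monomial `e ^ i` by torus semi-invariance, and `i` is the exponent of
`d ^ p + a b ^ (p - 1)`. The exponent `lam.1 + (p - 1) l` of `b` is nonnegative by regularity
along the curve of blocks `!![-1, b; 0, 1]` at `b = 0`. -/
theorem weight_eq [Infinite k] (hs : IsSemiinvariant p lam h) (hne : ∃ g, h g ≠ 0) :
    ∃ i j l : ℕ, lam = i • ((0 : ℤ), -((p : ℤ) * ((p : ℤ) - 1))) + j • ((1 : ℤ), -(p : ℤ)) +
      l • (1 - (p : ℤ), 1 - (p : ℤ)) := by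
  have hp := (Fact.out : p.Prime)
  have hp1 : p - 1 ≠ 0 := by have := hp.one_lt; omega
  obtain ⟨Φ, hΦ⟩ := hs.exists_slice_polynomial
  have hΦ0 : Φ ≠ 0 := by
    rintro rfl
    obtain ⟨e, c, hec⟩ := hs.exists_slice_ne_zero hne
    exact hec (by rw [hΦ, evalEval_zero])
  obtain ⟨Ψ, hΨ, hΨ0⟩ := exists_eq_pow_rootMultiplicity_mul_and_not_dvd Φ hΦ0 0
  set l := rootMultiplicity 0 Φ
  rw [C_0, sub_zero] at hΨ hΨ0
  have hev : ∀ e c, h (slice e c) = c ^ l * Ψ.evalEval e c := fun e c => by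
    rw [hΦ, hΨ, evalEval_mul, evalEval_pow, evalEval_X]
  have hq0 : Ψ.coeff 0 ≠ 0 := fun h0 => hΨ0 (X_dvd_iff.mpr h0)
  have hΨe : ∀ e, Ψ.evalEval e 0 = (Ψ.coeff 0).eval e := fun e => by
    rw [evalEval, C_0, ← coeff_zero_eq_eval_zero]
  set M : ℤ := -(p * lam.1 + lam.2) - ((p + 1) * (p - 1) * l : ℤ) with hM
  obtain ⟨hq1, i, hi⟩ := exists_mul_eq_of_quasihomogeneous hq0 (n := p * (p - 1))
    (Nat.mul_ne_zero hp.ne_zero hp1) (M := M) (by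
    intro y hy e
    -- Both sides are the values at `c = 0` of polynomials in `c`.
    let A : k[X] := C (y ^ ((p + 1) * (p - 1) * l)) *
      (Ψ.map (evalRingHom (y ^ (p * (p - 1)) * e))).comp (C (y ^ ((p + 1) * (p - 1))) * X)
    let B : k[X] := C (y ^ (-(p * lam.1 + lam.2))) * Ψ.map (evalRingHom e)
    have hmap : ∀ x c, (Ψ.map (evalRingHom x)).eval c = Ψ.evalEval x c := fun x c =>
      map_evalRingHom_eval x c Ψ
    have hAB : A = B := by
      refine eq_of_infinite_eval_eq A B (Set.Infinite.mono (s := {0}ᶜ) (fun c hc => ?_)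
        (Set.finite_singleton _).infinite_compl)
      have hc : c ≠ 0 := hc
      have := hs.slice_torus hy e hc
      rw [hev, hev, mul_pow, ← pow_mul] at this
      simp only [Set.mem_ofPred_eq, A, B, eval_mul, eval_C, eval_comp, eval_X, hmap]
      refine mul_left_cancel₀ (pow_ne_zero l hc) ?_
      linear_combination this
    have := congrArg (eval 0) hAB
    simp only [A, B, eval_mul, eval_C, eval_comp, eval_X, hmap, mul_zero, hΨe] at this
    rw [hM, zpow_sub₀ hy, div_mul_eq_mul_div, eq_div_iff (zpow_ne_zero _ hy), ← this, mul_comm]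
    congr 1
    rw [← zpow_natCast]
    congr 1
    push_cast [hp.one_le]
    ring)
  have ht : 0 ≤ lam.1 + (p - 1 : ℤ) * l := by
    by_contra! ht
    -- With `N = -(lam.1 + (p - 1) l) > 0`, the polynomial `b ^ N * h` along the curve equals
    -- `Ψ (1 - b ^ (p - 1), b ^ (p - 1))`, whose value at `b = 0` is `(Ψ.coeff 0).eval 1 ≠ 0`.
    obtain ⟨G, hG⟩ := hs.exists_eq_along (R := k[X])
      !![-1, X, 0, 0; 0, 1, 0, 0; 0, 0, 1, X; 0, 0, 0, -1]
    obtain ⟨N, hN⟩ := Int.eq_ofNat_of_zero_le (neg_nonneg.mpr ht.le)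
    have hN0 : N ≠ 0 := by rintro rfl; simp at hN; omega
    let A : k[X] := aevalAeval (1 - X ^ (p - 1)) (X ^ (p - 1)) Ψ
    have hA : ∀ b, A.eval b = Ψ.evalEval (1 - b ^ (p - 1)) (b ^ (p - 1)) := by
      intro b
      have : (aeval b).comp (aevalAeval (R := k) (1 - X ^ (p - 1) : k[X]) (X ^ (p - 1))) =
          aevalAeval (1 - b ^ (p - 1)) (b ^ (p - 1)) := by
        ext <;> simp
      rw [← coe_aevalAeval_eq_evalEval, ← this, AlgHom.comp_apply, coe_aeval_eq_eval]
    have hGA : X ^ N * G = A := by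
      refine eq_of_infinite_eval_eq _ _ (Set.Infinite.mono (s := {0}ᶜ) (fun b hb => ?_)
        (Set.finite_singleton _).infinite_compl)
      have hb : b ≠ 0 := hb
      have hdet : (!![-1, b; 0, 1]).det ≠ 0 := by simp [Matrix.det_fin_two]
      have h1 := hs.levi_eq_slice hdet (by simpa using hb)
      have h2 : h (levi _ hdet : Sp4 k) = G.eval b := by
        rw [← coe_aeval_eq_eval]
        refine hG _ _ ?_
        ext i j
        fin_cases i <;> fin_cases j <;> simp [levi, Matrix.det_fin_two]
      rw [h2, hev] at h1
      have h3 : (!![-1, b; 0, 1]).det = -1 := by simp [Matrix.det_fin_two]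
      rw [h3] at h1
      simp only [Matrix.of_apply, Matrix.cons_val', Matrix.cons_val_zero, Matrix.cons_val_one,
        Matrix.cons_val_fin_one, one_pow, mul_neg, mul_one, neg_neg, neg_mul, one_mul,
        ← sub_eq_add_neg] at h1
      simp only [Set.mem_ofPred_eq, eval_mul, eval_pow, eval_X, hA, h1]
      rw [← mul_assoc, ← mul_assoc]
      convert one_mul _ using 2
      rw [← zpow_natCast, ← zpow_natCast, ← zpow_natCast, ← zpow_mul, ← zpow_add₀ hb,
        ← zpow_add₀ hb, ← zpow_zero b]
      congr 1
      rw [← hN]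
      push_cast [hp.one_le]
      ring
    have := congrArg (eval 0) hGA
    rw [eval_mul, eval_pow, eval_X, zero_pow hN0, zero_mul, hA, zero_pow hp1, sub_zero, hΨe] at this
    exact hq1 this.symm
  obtain ⟨j, hj⟩ := Int.eq_ofNat_of_zero_le ht
  refine ⟨i, j, l, ?_⟩
  have hi' : (p : ℤ) * (p - 1) * i = -(p * lam.1 + lam.2) - (p + 1) * (p - 1) * l := by
    rw [← hM, ← hi]; push_cast [hp.one_le]; ring
  ext
  · simp only [Prod.smul_fst, Prod.fst_add]
    simp only [nsmul_eq_mul]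
    rw [← hj]; ring
  · simp only [Prod.smul_snd, Prod.snd_add]
    simp only [nsmul_eq_mul]
    rw [← hj]; linear_combination hi'

end IsSemiinvariant

end Weights

/-! ### Sections from semi-invariants of `2 × 2` matrices -/

section Semiinvariants

variable (p : ℕ) [Fact p.Prime] (k : Type*) [Field k] [Algebra (ZMod p) k]

/-- `lam` is the weight of a polynomial function on `2 × 2` matrices that is semi-invariant for
Frobenius-twisted conjugation `A ↦ b⁻¹ A φ(b)` by lower triangular `b`, and takes the value `1` at
a fixed invertible matrix. -/
def IsSemiinvariantWeight (lam : ℤ × ℤ) : Prop :=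
  ∃ F : MvPolynomial (Fin 2 × Fin 2) k,
    F.eval (fun ij => !![(1 : k), 1; -1, 0] ij.1 ij.2) = 1 ∧
    ∀ b A A' : Matrix (Fin 2) (Fin 2) k, b 0 1 = 0 → b 0 0 ≠ 0 → b 1 1 ≠ 0 →
      b * A' = A * b.map (frob p k) →
        F.eval (fun ij => A' ij.1 ij.2) =
          (b 0 0 ^ lam.1 * b 1 1 ^ lam.2)⁻¹ * F.eval fun ij => A ij.1 ij.2

variable {p k}

theorem isSemiinvariantWeight_zero : IsSemiinvariantWeight p k 0 :=
  ⟨1, by simp, by simp⟩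

theorem IsSemiinvariantWeight.add {x y : ℤ × ℤ} (hx : IsSemiinvariantWeight p k x)
    (hy : IsSemiinvariantWeight p k y) : IsSemiinvariantWeight p k (x + y) := by
  obtain ⟨F, hF, hF'⟩ := hx
  obtain ⟨H, hH, hH'⟩ := hy
  refine ⟨F * H, by rw [map_mul, hF, hH, one_mul], fun b A A' h01 h0 h1 h => ?_⟩
  rw [map_mul, map_mul, hF' b A A' h01 h0 h1 h, hH' b A A' h01 h0 h1 h, Prod.fst_add,
    Prod.snd_add, zpow_add₀ h0, zpow_add₀ h1, mul_inv, mul_inv, mul_inv, mul_inv, mul_inv]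
  ring

theorem twisted_conj_entries {b A A' : Matrix (Fin 2) (Fin 2) k} (h01 : b 0 1 = 0)
    (h : b * A' = A * b.map (frob p k)) :
    b 0 0 * A' 0 0 = A 0 0 * b 0 0 ^ p + A 0 1 * b 1 0 ^ p ∧
    b 0 0 * A' 0 1 = A 0 1 * b 1 1 ^ p ∧
    b 1 0 * A' 0 1 + b 1 1 * A' 1 1 = A 1 1 * b 1 1 ^ p := by
  have hp : (0 : k) ^ p = 0 := zero_pow (Fact.out : p.Prime).ne_zero
  have e00 := congrFun (congrFun h 0) 0
  have e01 := congrFun (congrFun h 0) 1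
  have e11 := congrFun (congrFun h 1) 1
  simp [Matrix.mul_apply, h01, frob_apply, hp] at e00 e01 e11
  exact ⟨e00, e01, e11⟩

/-- The upper right entry is a semi-invariant. -/
theorem isSemiinvariantWeight_entry : IsSemiinvariantWeight p k (1, -(p : ℤ)) := by
  refine ⟨MvPolynomial.X (0, 1), by simp, fun b A A' h01 h0 h1 h => ?_⟩
  obtain ⟨-, h2, -⟩ := twisted_conj_entries h01 h
  simp only [MvPolynomial.eval_X, zpow_one, zpow_neg, zpow_natCast]
  field_simp
  linear_combination h2

/-- The determinant is a semi-invariant. -/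
theorem isSemiinvariantWeight_det :
    IsSemiinvariantWeight p k (1 - (p : ℤ), 1 - (p : ℤ)) := by
  refine ⟨MvPolynomial.X (0, 0) * MvPolynomial.X (1, 1) -
    MvPolynomial.X (0, 1) * MvPolynomial.X (1, 0), by simp, fun b A A' h01 h0 h1 h => ?_⟩
  have hp : (0 : k) ^ p = 0 := zero_pow (Fact.out : p.Prime).ne_zero
  have hd := congrArg Matrix.det h
  rw [Matrix.det_mul, Matrix.det_mul] at hd
  simp [Matrix.det_fin_two, h01, frob_apply, hp] at hd
  simp only [map_sub, map_mul, MvPolynomial.eval_X, zpow_sub₀ h0, zpow_sub₀ h1, zpow_one,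
    zpow_natCast]
  field_simp
  linear_combination hd

/-- The function `d ^ p + a b ^ (p - 1)` of `!![a, b; c, d]` is a semi-invariant. -/
theorem isSemiinvariantWeight_norm :
    IsSemiinvariantWeight p k ((0 : ℤ), -((p : ℤ) * ((p : ℤ) - 1))) := by
  have hp := (Fact.out : p.Prime)
  obtain ⟨q, hq⟩ : ∃ q, p = q + 1 := ⟨p - 1, by have := hp.one_lt; omega⟩
  refine ⟨MvPolynomial.X (1, 1) ^ p + MvPolynomial.X (0, 0) * MvPolynomial.X (0, 1) ^ (p - 1),
    by simp [hp.ne_zero], fun b A A' h01 h0 h1 h => ?_⟩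
  obtain ⟨e1, e2, e3⟩ := twisted_conj_entries h01 h
  -- In characteristic `p`, the `p`-th power of the last relation is again a sum of monomials.
  have e4 : b 1 0 ^ p * A' 0 1 ^ p + b 1 1 ^ p * A' 1 1 ^ p = A 1 1 ^ p * (b 1 1 ^ p) ^ p := by
    have := congrArg (frob p k) e3
    simpa only [map_add, map_mul, frob_apply] using this
  have hexp : b 1 1 ^ (-((p : ℤ) * ((p : ℤ) - 1))) = ((b 1 1 ^ p) ^ q)⁻¹ := by
    rw [← pow_mul, ← zpow_natCast, ← zpow_neg]; congr 1; rw [hq]; push_cast; ring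
  simp only [map_add, map_mul, map_pow, MvPolynomial.eval_X, zpow_zero, one_mul, hexp, inv_inv]
  have hpq : p - 1 = q := by omega
  rw [hpq]
  have e2' : A' 0 1 = A 0 1 * b 1 1 ^ p / b 0 0 := by field_simp; linear_combination e2
  have e1' : A' 0 0 = (A 0 0 * b 0 0 ^ p + A 0 1 * b 1 0 ^ p) / b 0 0 := by
    field_simp; linear_combination e1
  have e4' : A' 1 1 ^ p =
      (A 1 1 ^ p * (b 1 1 ^ p) ^ p - b 1 0 ^ p * A' 0 1 ^ p) / b 1 1 ^ p := by
    field_simp; linear_combination e4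
  rw [e4', e1', e2']
  have hy : b 1 1 ^ p ≠ 0 := pow_ne_zero _ h1
  generalize b 1 1 ^ p = y at hy ⊢
  generalize b 1 0 ^ p = z
  generalize A 1 1 ^ p = d
  generalize b 0 0 = x at h0 ⊢
  rw [hq]
  simp only [div_pow, mul_pow, pow_succ]
  field_simp
  ring

end Semiinvariants

section Regular

variable (k : Type*) [Field k]

/-- Regular maps from `Sp(4)` to the algebra of functions on a set are closed under products. -/
theorem mul_mem_regularMaps {X : Type*} {F H : Sp4 k → X → k} (hF : F ∈ regularMaps k (X → k))
    (hH : H ∈ regularMaps k (X → k)) : F * H ∈ regularMaps k (X → k) := by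
  have := Submodule.mul_mem_mul hF hH
  rw [regularMaps, Submodule.span_mul_span] at this
  refine Submodule.span_mono ?_ this
  rintro _ ⟨_, ⟨f, ⟨Pf, hf⟩, v, rfl⟩, _, ⟨h, ⟨Ph, hh⟩, w, rfl⟩, rfl⟩
  refine ⟨f * h, ⟨Pf * Ph, fun g => by simp [hf g, hh g]⟩, v * w, ?_⟩
  funext g x
  simp
  ring

theorem entry_mem_regularMaps {X : Type*} (i j : Fin 4) :
    (fun g _ => mat g i j : Sp4 k → X → k) ∈ regularMaps k (X → k) :=
  Submodule.subset_span ⟨fun g => mat (g : Sp4 k) i j, ⟨MvPolynomial.X (i, j), by simp⟩, 1, by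
    funext g x; simp⟩

theorem const_mem_regularMaps {X : Type*} (v : X → k) :
    (fun _ => v : Sp4 k → X → k) ∈ regularMaps k (X → k) :=
  Submodule.subset_span ⟨1, ⟨1, by simp⟩, v, by funext g x; simp⟩

/-- A map into a subspace that is regular into the ambient space is regular: compose with a
linear retraction. -/
theorem regularMaps_of_subtype {M : Type*} [AddCommGroup M] [Module k M] (W : Submodule k M)
    (F : Sp4 k → W) (hF : (fun g => (F g : M)) ∈ regularMaps k M) : F ∈ regularMaps k W := by
  obtain ⟨π, hπ⟩ := W.subtype.exists_leftInverse_of_injective W.ker_subtype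
  have key : regularMaps k M ≤ (regularMaps k W).comap (π.compLeft (Sp4 k)) := by
    refine Submodule.span_le.mpr ?_
    rintro _ ⟨f, hf, v, rfl⟩
    exact Submodule.subset_span ⟨f, hf, π v, by funext g; simp⟩
  have hFπ : F = fun g => π (F g) := funext fun g => (LinearMap.congr_fun hπ (F g)).symm
  rw [hFπ]
  exact key hF

theorem eval_mem_regularMaps {X σ : Type*} (a : σ → Sp4 k → X → k)
    (ha : ∀ i, a i ∈ regularMaps k (X → k)) (F : MvPolynomial σ k) :
    (fun g x => F.eval fun i => a i g x) ∈ regularMaps k (X → k) := by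
  induction F using MvPolynomial.induction_on with
  | C c => simpa using const_mem_regularMaps k fun _ => c
  | add F H hF hH =>
    simp only [map_add]
    exact Submodule.add_mem _ hF hH
  | mul_X F i hF =>
    simp only [map_mul, MvPolynomial.eval_X]
    exact mul_mem_regularMaps k hF (ha i)

/-- Composites of polynomials with regular functions are regular. -/
theorem eval_mem_regularFunctions {σ : Type*} {H : Subgroup (Sp4 k)} (a : σ → H → k)
    (ha : ∀ i, a i ∈ regularFunctions k H) (F : MvPolynomial σ k) :
    (fun h => F.eval fun i => a i h) ∈ regularFunctions k H := by
  choose Q hQ using ha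
  refine ⟨MvPolynomial.bind₁ Q F, fun h => ?_⟩
  refine Eq.trans ?_ (MvPolynomial.eval₂Hom_bind₁ (RingHom.id k) _ _ F).symm
  exact congrArg (fun v => MvPolynomial.eval₂Hom (RingHom.id k) v F) (funext fun i => hQ i h)

end Regular

section Construction

variable (p : ℕ) [Fact p.Prime] (k : Type*) [Field k] [Algebra (ZMod p) k]

theorem topLeft_inv_mul (l : L k) : topLeft (l : Sp4 k)⁻¹ * topLeft (l : Sp4 k) = 1 := by
  rw [← topLeft_mul_of_mem_P ((P k).inv_mem l.2.1), inv_mul_cancel, topLeft_one]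

theorem topLeft_twisted_mul (x y : L k) (g : Sp4 k) :
    topLeft ((x : Sp4 k) * g * frobSp4 p k (y : Sp4 k)) =
      topLeft (x : Sp4 k) * topLeft g * (topLeft (y : Sp4 k)).map (frob p k) := by
  rw [topLeft_mul_of_mem_Q _ (frobSp4_mem_L p y).2, topLeft_mul_of_mem_P x.2.1, topLeft_frobSp4]

theorem topLeft_apply (g : Sp4 k) (i j : Fin 2) :
    topLeft g i j = mat g (i.castLE (by omega)) (j.castLE (by omega)) := by
  fin_cases i <;> fin_cases j <;> rfl

/-- Entries of `l⁻¹ g φ(l)` are regular functions of `l` for fixed `g`. -/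
theorem twisted_entry_regular (g : Sp4 k) (i j : Fin 4) :
    (fun l : L k => mat ((l : Sp4 k)⁻¹ * g * frobSp4 p k (l : Sp4 k)) i j) ∈
      regularFunctions k (L k) := by
  let Y : Matrix (Fin 4) (Fin 4) (MvPolynomial (Fin 4 × Fin 4) k) := fun i j =>
    MvPolynomial.X (i, j)
  refine ⟨((-(formMatrix k)).map MvPolynomial.C * Y.transpose * (formMatrix k).map MvPolynomial.C *
    (mat g).map MvPolynomial.C * Y.map (· ^ p) : Matrix (Fin 4) (Fin 4) _) i j, fun l => ?_⟩
  have hmap : ∀ M : Matrix (Fin 4) (Fin 4) (MvPolynomial (Fin 4 × Fin 4) k),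
      (MvPolynomial.eval fun ij => mat (l : Sp4 k) ij.1 ij.2) (M i j) =
        M.map (MvPolynomial.eval fun ij => mat (l : Sp4 k) ij.1 ij.2) i j := fun M => rfl
  refine Eq.trans ?_ (hmap _).symm
  beta_reduce
  rw [mat_mul, mat_mul, mat_inv_eq, mat_frobSp4]
  simp only [Matrix.map_mul]
  refine congrFun (congrFun ?_ i) j
  congr 1
  · congr 1
    · congr 1
      · congr 1
        · ext a b; simp
        · ext a b
          rw [Matrix.map_apply, Matrix.transpose_apply, Matrix.transpose_apply]
          simp [Y]
      · ext a b; simp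
    · ext a b; simp
  · ext a b
    rw [Matrix.map_apply, Matrix.map_apply, Matrix.map_apply]
    simp [Y, frob_apply]

theorem twisted_entry_mem_regularMaps (i j : Fin 4) :
    (fun g l => mat ((l : Sp4 k)⁻¹ * g * frobSp4 p k (l : Sp4 k)) i j : Sp4 k → L k → k) ∈
      regularMaps k (L k → k) := by
  have : (fun g l => mat ((l : Sp4 k)⁻¹ * g * frobSp4 p k (l : Sp4 k)) i j : Sp4 k → L k → k) =
      ∑ n : Fin 4, (∑ m : Fin 4, (fun _ l => mat ((l : Sp4 k)⁻¹) i m : Sp4 k → L k → k) *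
        (fun g _ => mat g m n : Sp4 k → L k → k)) *
        (fun _ l => mat (frobSp4 p k (l : Sp4 k)) n j : Sp4 k → L k → k) := by
    funext g l
    simp [mat_mul, Matrix.mul_apply]
  rw [this]
  exact Submodule.sum_mem _ fun n _ => mul_mem_regularMaps k (Submodule.sum_mem _ fun m _ =>
    mul_mem_regularMaps k (const_mem_regularMaps k _) (entry_mem_regularMaps k m n))
    (const_mem_regularMaps k _)

variable {p k}

/-- A semi-invariant `h` on `2 × 2` matrices defines the section
`g ↦ (l ↦ h (topLeft (l⁻¹ g φ(l))))`. -/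
theorem IsSemiinvariantWeight.mem_Czip {lam : ℤ × ℤ} (h : IsSemiinvariantWeight p k lam) :
    lam ∈ Czip k p := by
  obtain ⟨F, hF, hF'⟩ := h
  let ev : Matrix (Fin 2) (Fin 2) k → k := fun A => F.eval fun ij => A ij.1 ij.2
  let f : Sp4 k → L k → k := fun g l =>
    ev (topLeft ((l : Sp4 k)⁻¹ * g * frobSp4 p k (l : Sp4 k)))
  have hfV : ∀ g, f g ∈ V k lam := by
    intro g
    refine ⟨eval_mem_regularFunctions k _ (fun ij => ?_) F, fun l b hb => ?_⟩
    · simp only [topLeft_apply]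
      exact twisted_entry_regular p k g _ _
    · have hb01 : mat (b : Sp4 k) 0 1 = 0 := hb (by decide)
      have hinv := topLeft_inv_mul k b
      have h00 := congrFun (congrFun hinv 0) 0
      have h01 := congrFun (congrFun hinv 0) 1
      have h11 := congrFun (congrFun hinv 1) 1
      simp [Matrix.mul_apply, topLeft, hb01] at h00 h01 h11
      have hb1 : mat (b : Sp4 k) 1 1 ≠ 0 := by
        rintro h0; simp [h0] at h11
      have hb0 : mat (b : Sp4 k) 0 0 ≠ 0 := by
        rcases h01 with h01 | h01
        · rintro h0; simp [h01, h0] at h00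
        · exact absurd h01 hb1
      refine hF' (topLeft (b : Sp4 k)) _ _ (by simpa [topLeft] using hb01)
        (by simpa [topLeft] using hb0) (by simpa [topLeft] using hb1) ?_
      have hb' : topLeft (b : Sp4 k) * topLeft (b : Sp4 k)⁻¹ = 1 :=
        mul_eq_one_comm.mp (topLeft_inv_mul k b)
      have e : (((l * b : L k) : Sp4 k))⁻¹ * g * frobSp4 p k ((l * b : L k) : Sp4 k) =
          ((b⁻¹ : L k) : Sp4 k) * ((l : Sp4 k)⁻¹ * g * frobSp4 p k (l : Sp4 k)) *
            frobSp4 p k (b : Sp4 k) := by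
        simp only [Subgroup.coe_mul, Subgroup.coe_inv, mul_inv_rev, map_mul, mul_assoc]
      rw [e, topLeft_twisted_mul, Subgroup.coe_inv, ← mul_assoc, ← mul_assoc, hb', one_mul]
  let S : Sp4 k → V k lam := fun g => ⟨f g, hfV g⟩
  have hS : S ∈ H0 k p lam := by
    refine ⟨regularMaps_of_subtype k _ _ (eval_mem_regularMaps k _ (fun ij => ?_) F), ?_⟩
    · simp only [topLeft_apply]
      exact twisted_entry_mem_regularMaps p k _ _
    · rintro ⟨x, y⟩ ⟨hx, hy, l', m, hl', hm, hlm⟩ l hl g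
      obtain rfl : l = l' := eq_of_topLeft_eq
        ((topLeft_of_isLeviComponent_RuP hl).symm.trans (topLeft_of_isLeviComponent_RuP hl'))
      refine Subtype.ext (funext fun z => congrArg ev ?_)
      have hyinv : topLeft y⁻¹ = topLeft (m : Sp4 k)⁻¹ := by
        have h1 : topLeft y⁻¹ * topLeft y = 1 := by
          rw [← topLeft_mul_of_mem_Q _ hy, inv_mul_cancel, topLeft_one]
        have h2 : topLeft y * topLeft y⁻¹ = 1 := mul_eq_one_comm.mp h1
        have h3 := topLeft_inv_mul k m
        rw [topLeft_of_isLeviComponent_RuQ hm] at h1 h2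
        calc topLeft y⁻¹ = (topLeft (m : Sp4 k)⁻¹ * topLeft (m : Sp4 k)) * topLeft y⁻¹ := by
              rw [h3, one_mul]
          _ = _ := by rw [mul_assoc, h2, mul_one]
      have hz : ((z : Sp4 k))⁻¹ ∈ P k := (P k).inv_mem z.2.1
      have hfz : frobSp4 p k (z : Sp4 k) ∈ Q k := (frobSp4_mem_L p z).2
      have hxl := topLeft_of_isLeviComponent_RuP hl
      change topLeft ((z : Sp4 k)⁻¹ * (x * g * y⁻¹) * frobSp4 p k (z : Sp4 k)) =
        topLeft (((l⁻¹ * z : L k) : Sp4 k)⁻¹ * g * frobSp4 p k ((l⁻¹ * z : L k) : Sp4 k))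
      have e : ((l⁻¹ * z : L k) : Sp4 k)⁻¹ * g * frobSp4 p k ((l⁻¹ * z : L k) : Sp4 k) =
          (z : Sp4 k)⁻¹ * ((l : Sp4 k) * g * (m : Sp4 k)⁻¹) * frobSp4 p k (z : Sp4 k) := by
        simp only [Subgroup.coe_mul, Subgroup.coe_inv, mul_inv_rev, inv_inv, map_mul, map_inv,
          hlm, mul_assoc]
      rw [e, topLeft_mul_of_mem_Q _ hfz, topLeft_mul_of_mem_P hz,
        topLeft_mul_of_mem_Q _ ((Q k).inv_mem hy), topLeft_mul_of_mem_P hx,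
        topLeft_mul_of_mem_Q _ hfz, topLeft_mul_of_mem_P hz,
        topLeft_mul_of_mem_Q _ ((Q k).inv_mem m.2.2), topLeft_mul_of_mem_P l.2.1, hyinv, hxl]
  intro hbot
  have h0 : S = 0 := (Submodule.mem_bot k).mp (hbot ▸ hS)
  have hdet : (!![(1 : k), 1; -1, 0]).det ≠ 0 := by simp [Matrix.det_fin_two]
  have h1 : f (levi _ hdet : Sp4 k) 1 = 0 := by
    have := congrArg Subtype.val (congrFun h0 (levi _ hdet : Sp4 k))
    exact congrFun this 1
  have h2 : f (levi _ hdet : Sp4 k) 1 = 1 := by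
    refine Eq.trans ?_ hF
    simp only [f, ev, Subgroup.coe_one, inv_one, one_mul, map_one, mul_one, topLeft_levi]
  exact one_ne_zero (h2.symm.trans h1)

end Construction

/-! ### Cones in the character lattice -/

section Cones

/-- The cone `{(a₁, a₂) : a₁ ≥ a₂, p a₁ + a₂ ≤ 0}`. -/
def zipCone (p : ℕ) : AddSubmonoid (ℤ × ℤ) where
  carrier := {a | a.2 ≤ a.1 ∧ (p : ℤ) * a.1 + a.2 ≤ 0}
  zero_mem' := by simp
  add_mem' := by
    rintro a b ⟨ha, ha'⟩ ⟨hb, hb'⟩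
    refine ⟨add_le_add ha hb, ?_⟩
    simp only [Prod.fst_add, Prod.snd_add]
    linarith

theorem mem_zipCone {p : ℕ} {a : ℤ × ℤ} :
    a ∈ zipCone p ↔ a.2 ≤ a.1 ∧ (p : ℤ) * a.1 + a.2 ≤ 0 := Iff.rfl

theorem saturation_subset_zipCone {p : ℕ} {C : Set (ℤ × ℤ)} (hC : C ⊆ zipCone p) :
    saturation C ⊆ zipCone p := by
  rintro a ⟨n, hn, ha⟩
  obtain ⟨h1, h2⟩ := mem_zipCone.mp (hC ha)
  have hn' : (0 : ℤ) < n := by exact_mod_cast hn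
  simp only [Prod.smul_fst, Prod.smul_snd] at h1 h2
  simp only [nsmul_eq_mul] at h1 h2
  refine mem_zipCone.mpr ⟨le_of_mul_le_mul_left h1 hn', ?_⟩
  by_contra! h
  nlinarith [mul_pos hn' h]

/-- A set of characters contained in the cone and containing all natural combinations of its
vectors `(1, -p)` and `(1 - p, 1 - p)` has the cone as saturation. -/
theorem saturation_eq_zipCone {p : ℕ} (hp : 2 ≤ p) {C : Set (ℤ × ℤ)} (hC : C ⊆ zipCone p)
    (h : ∀ i j : ℕ, i • ((1 : ℤ), -(p : ℤ)) + j • (1 - (p : ℤ), 1 - (p : ℤ)) ∈ C) :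
    saturation C = zipCone p := by
  refine (saturation_subset_zipCone hC).antisymm fun a ha => ?_
  obtain ⟨h1, h2⟩ := mem_zipCone.mp ha
  obtain ⟨q, rfl⟩ : ∃ q, p = q + 1 := ⟨p - 1, by omega⟩
  -- `(p + 1) (p - 1) a = (p - 1) (a₁ - a₂) (1, -p) - (p a₁ + a₂) (1 - p, 1 - p)`.
  refine ⟨(q + 2) * q, Nat.mul_pos (by omega) (by omega), ?_⟩
  obtain ⟨s, hs⟩ := Int.eq_ofNat_of_zero_le (sub_nonneg.mpr h1)
  obtain ⟨t, ht⟩ := Int.eq_ofNat_of_zero_le (neg_nonneg.mpr h2)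
  convert h (q * s) t using 1
  ext
  · simp only [Prod.smul_fst, Prod.fst_add]
    simp only [nsmul_eq_mul]
    push_cast at ht ⊢
    rw [← hs, ← ht]; ring
  · simp only [Prod.smul_snd, Prod.snd_add]
    simp only [nsmul_eq_mul]
    push_cast at ht ⊢
    rw [← hs, ← ht]; ring

theorem sGenerated_eq_zipCone (p : ℕ) :
    sGenerated {((1 : ℤ), -(p : ℤ)), ((-1 : ℤ), (-1 : ℤ))} = zipCone p := by
  refine le_antisymm (sInf_le ⟨?_, ?_⟩) (le_sInf ?_)
  · exact (saturation_subset_zipCone subset_rfl).antisymm fun a ha =>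
      ⟨1, le_rfl, by rwa [one_smul]⟩
  · rintro a (rfl | rfl) <;> simp only [SetLike.mem_coe, mem_zipCone] <;>
      refine ⟨?_, ?_⟩ <;> simp
  · rintro C ⟨hC, hS⟩ a ha
    obtain ⟨h1, h2⟩ := mem_zipCone.mp ha
    change a ∈ (C : Set (ℤ × ℤ))
    rw [← hC]
    -- `(p + 1) a = (a₁ - a₂) (1, -p) - (p a₁ + a₂) (-1, -1)`.
    refine ⟨p + 1, by omega, ?_⟩
    obtain ⟨s, hs⟩ := Int.eq_ofNat_of_zero_le (sub_nonneg.mpr h1)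
    obtain ⟨t, ht⟩ := Int.eq_ofNat_of_zero_le (neg_nonneg.mpr h2)
    have h := C.add_mem (C.nsmul_mem (hS (Set.mem_insert _ _)) s)
      (C.nsmul_mem (hS (Set.mem_insert_of_mem _ (Set.mem_singleton _))) t)
    change (p + 1) • a ∈ C
    convert h using 1
    ext
    · simp only [Prod.smul_fst, Prod.fst_add]
      simp only [nsmul_eq_mul]
      push_cast
      rw [← hs, ← ht]; ring
    · simp only [Prod.smul_snd, Prod.snd_add]
      simp only [nsmul_eq_mul]
      push_cast
      rw [← hs, ← ht]; ring

theorem schubertMap_apply (p : ℕ) (x : ℤ × ℤ) :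
    schubertMap p x = (x.1 - p * x.2, x.2 - p * x.1) := by
  obtain ⟨a, b⟩ := x
  have : (frameElt * w0) (a, b) = (b, a) := by
    rw [frameElt, mul_assoc, LinearEquiv.mul_apply, LinearEquiv.mul_apply, w0_apply, w0_apply,
      neg_neg, w0L_apply]
  simp [schubertMap, this]

theorem saturation_CSbt {p : ℕ} (hp : 2 ≤ p) : saturation (CSbt p) = zipCone p := by
  have hp' : (2 : ℤ) ≤ p := by exact_mod_cast hp
  refine saturation_eq_zipCone hp ?_ fun i j => ?_
  · rintro _ ⟨x, hx, rfl⟩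
    have h0 := hx 0
    have h1 := hx 1
    simp [pairing, simpleCoroot] at h0 h1
    rw [SetLike.mem_coe, mem_zipCone, schubertMap_apply]
    constructor
    · nlinarith
    · nlinarith [mul_nonneg h1 (sub_nonneg.mpr (show (1 : ℤ) ≤ (p : ℤ) * p by nlinarith))]
  · refine ⟨((i + j : ℕ), (j : ℕ)), ?_, ?_⟩
    · intro l; fin_cases l <;> simp [pairing, simpleCoroot]
    · rw [schubertMap_apply]
      ext <;> simp <;> ring

theorem simpleReflection_zero_apply (a b : ℤ) : simpleReflection 0 (a, b) = (b, a) :=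
  w0L_apply a b

theorem simpleReflection_zero_ne_one : simpleReflection 0 ≠ 1 := fun h => by
  have := congrArg (fun w : (ℤ × ℤ) ≃ₗ[ℤ] (ℤ × ℤ) => w (1, 0)) h
  simp [simpleReflection_zero_apply] at this

theorem length_one : length 1 = 0 :=
  Nat.sInf_eq_zero.mpr (Or.inl ⟨[], rfl, rfl⟩)

theorem length_simpleReflection_zero : length (simpleReflection 0) = 1 := by
  refine le_antisymm (Nat.sInf_le ⟨[0], rfl, by simp⟩) (Nat.one_le_iff_ne_zero.mpr fun h => ?_)
  rcases Nat.sInf_eq_zero.mp h with ⟨u, hu, hu'⟩ | h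
  · rw [List.length_eq_zero_iff.mp hu] at hu'
    exact simpleReflection_zero_ne_one hu'.symm
  · have : (1 : ℕ) ∈ (∅ : Set ℕ) := h ▸ ⟨[0], rfl, by simp⟩
    exact this

theorem mem_weylL {w : (ℤ × ℤ) ≃ₗ[ℤ] (ℤ × ℤ)} :
    w ∈ weylL ↔ w = 1 ∨ w = simpleReflection 0 := by
  have hs : simpleReflection 0 * simpleReflection 0 = 1 := by
    refine LinearEquiv.ext fun ⟨a, b⟩ => ?_
    rw [LinearEquiv.mul_apply, simpleReflection_zero_apply, simpleReflection_zero_apply]; rfl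
  constructor
  · intro hw
    induction hw using Subgroup.closure_induction with
    | mem x hx => exact Or.inr hx
    | one => exact Or.inl rfl
    | mul x y _ _ hx hy =>
      rcases hx with rfl | rfl <;> rcases hy with rfl | rfl <;> simp [hs]
    | inv x _ hx =>
      rcases hx with rfl | rfl
      · simp
      · exact Or.inr (inv_eq_of_mul_eq_one_left hs)
  · rintro (rfl | rfl)
    · exact weylL.one_mem
    · exact Subgroup.subset_closure rfl

theorem Chw_eq_zipCone (p : ℕ) : Chw p = zipCone p := by
  have hW : (weylL : Set ((ℤ × ℤ) ≃ₗ[ℤ] (ℤ × ℤ))) = {1, simpleReflection 0} := by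
    ext w; exact mem_weylL
  ext ⟨a, b⟩
  have hsum : ∑ᶠ w : weylL, (p : ℤ) ^ length w.1 * pairing 1 (w.1 (a, b)) = b + p * a := by
    refine (finsum_set_coe_eq_finsum_mem (weylL : Set ((ℤ × ℤ) ≃ₗ[ℤ] (ℤ × ℤ)))
      (f := fun w => (p : ℤ) ^ length w * pairing 1 (w (a, b)))).trans ?_
    rw [hW, finsum_mem_pair simpleReflection_zero_ne_one.symm, length_one,
      length_simpleReflection_zero, simpleReflection_zero_apply]
    simp [pairing, simpleCoroot]
  change (0 ≤ pairing 0 (a, b) ∧ _ ≤ 0) ↔ _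
  rw [hsum, SetLike.mem_coe, mem_zipCone]
  simp only [pairing, simpleCoroot]
  simp
  intro _
  rw [add_comm]

end Cones

/-! ### The zip cone -/

section ZipCone

variable (p : ℕ) [Fact p.Prime] (k : Type*) [Field k] [Algebra (ZMod p) k]

theorem Czip_eq_closure [Infinite k] :
    Czip k p = (AddSubmonoid.closure
      {((1 : ℤ), -(p : ℤ)), (1 - (p : ℤ), 1 - (p : ℤ)), ((0 : ℤ), -((p : ℤ) * ((p : ℤ) - 1)))} :
      Set (ℤ × ℤ)) := by
  ext lam
  constructor
  · intro hlam
    obtain ⟨h, hs, hne⟩ := exists_isSemiinvariant hlam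
    obtain ⟨i, j, l, rfl⟩ := hs.weight_eq hne
    refine add_mem (add_mem ?_ ?_) ?_ <;>
      exact nsmul_mem (AddSubmonoid.subset_closure (by simp)) _
  · intro hlam
    refine IsSemiinvariantWeight.mem_Czip ?_
    induction hlam using AddSubmonoid.closure_induction with
    | mem x hx =>
      rcases hx with rfl | rfl | rfl
      · exact isSemiinvariantWeight_entry
      · exact isSemiinvariantWeight_det
      · exact isSemiinvariantWeight_norm
    | zero => exact isSemiinvariantWeight_zero
    | add x y _ _ hx hy => exact hx.add hy

theorem saturation_Czip [Infinite k] : saturation (Czip k p) = zipCone p := by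
  have hp : 2 ≤ p := (Fact.out : p.Prime).two_le
  have hp' : (2 : ℤ) ≤ p := by exact_mod_cast hp
  rw [Czip_eq_closure]
  refine saturation_eq_zipCone hp ?_ fun i j => add_mem ?_ ?_
  · refine SetLike.coe_subset_coe.mpr (AddSubmonoid.closure_le.mpr ?_)
    rintro _ (rfl | rfl | rfl) <;> simp only [SetLike.mem_coe, mem_zipCone] <;>
      constructor <;> nlinarith
  · exact nsmul_mem (AddSubmonoid.subset_closure (by simp)) _
  · exact nsmul_mem (AddSubmonoid.subset_closure (by simp)) _

end ZipCone

end ZipSp4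

end

theorem mainTheorem6 (p : ℕ) [Fact p.Prime] (k : Type*) [Field k] [Algebra (ZMod p) k]
    [IsAlgClosure (ZMod p) k] :
    ZipSp4.Czip k p =
        (AddSubmonoid.closure
          {((1 : ℤ), -(p : ℤ)), (1 - (p : ℤ), 1 - (p : ℤ)), ((0 : ℤ), -((p : ℤ) * ((p : ℤ) - 1)))} :
          Set (ℤ × ℤ)) ∧
      ZipSp4.saturation (ZipSp4.Czip k p) =
        {a : ℤ × ℤ | a.2 ≤ a.1 ∧ (p : ℤ) * a.1 + a.2 ≤ 0} ∧
      ZipSp4.saturation (ZipSp4.Czip k p) =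
        (ZipSp4.sGenerated {((1 : ℤ), -(p : ℤ)), ((-1 : ℤ), (-1 : ℤ))} : Set (ℤ × ℤ)) ∧
      ZipSp4.saturation (ZipSp4.Czip k p) = ZipSp4.saturation (ZipSp4.CSbt p) ∧
      ZipSp4.saturation (ZipSp4.Czip k p) = ZipSp4.Chw p := by
  have : IsAlgClosed k := IsAlgClosure.isAlgClosed (ZMod p)
  refine ⟨ZipSp4.Czip_eq_closure p k, ?_⟩
  rw [ZipSp4.saturation_Czip, ZipSp4.sGenerated_eq_zipCone,
    ZipSp4.saturation_CSbt (Fact.out : p.Prime).two_le, ZipSp4.Chw_eq_zipCone]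
  exact ⟨rfl, rfl, rfl, rfl⟩
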